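/- Let $\mathbb E^4_2$ be $\mathbb R^4$ with the metric $\langle\cdot,\cdot\rangle = dx_1^2+dx_2^2-dx_3^2-dx_4^2$. A surface $z=z(u,v)$ (a smooth map on a plane domain) with tangent planes $T_p$ and normal planes $N_p$ is \emph{Lorentz} if $\mathbb E^4_2=T_p\oplus N_p$ and the metric has signature $(1,1)$ on both $T_p$ and $N_p$; it is \emph{minimal} if its mean curvature vector vanishes. Let $\sigma$ be its second fundamental form, $K$ its Gauss curvature and $\varkappa$ its normal curvature (the latter is defined up to sign). A minimal Lorentz surface is \emph{of general type} if the span of the values of $\sigma$ is two-dimensional at every point and $K^2-\varkappa^2>0$ on a dense open subset. A \emph{geometric frame field} is a smooth frame field $\{x,y,n_1,n_2\}$, with $x,y$ tangent and $n_1,n_2$ normal, which is orthonormal with $\langle x,x\rangle=1$, $\langle y,y\rangle=-1$, $\langle n_1,n_1\rangle=\varepsilon$, $\langle n_2,n_2\rangle=-\varepsilon$ $(\varepsilon=\pm1)$, and which satisfies $$\sigma(x,x)=\sigma(y,y)=\nu\, n_1,\qquad \sigma(x,y)=\mu\, n_2,\qquad \mu\nu\neq0;$$ the functions $\mu,\nu$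 are the corresponding \emph{geometric functions}. Surfaces of general type are always considered in isothermal parameters along the canonical directions, i.e. $z_u=f\,x$, $z_v=f\,y$ with a positive function $f$. Such parameters are \emph{canonical} if, for the coefficients $E=\langle z_u,z_u\rangle$, $F=\langle z_u,z_v\rangle$, $G=\langle z_v,z_v\rangle$ of the first fundamental form, $E=-G=1/\sqrt{|\mu^2-\nu^2|}$ and $F=0$. \textbf{Theorem.} Let $\mu,\nu$ be smooth functions on a domain $\mathcal D\subset\mathbb R^2$ and let $\varepsilon=\pm1$. Suppose that $\mu\nu\ne0$ and $\mu^2-\nu^2\neq0$ everywhere on $\mathcal D$, and that $$\sqrt{|\mu^2-\nu^2|}\;\Delta^h\ln|\mu^2-\nu^2|=-4\varepsilon(\mu^2+\nu^2),\qquad \sqrt{|\mu^2-\nu^2|}\;\Delta^h\ln\left|\frac{\mu+\nu}{\mu-\nu}\right|=-4\varepsilon\mu\nu,$$ where $\Delta^h=\partial^2/\partial u^2-\partial^2/\partial v^2$. (1) Let $(u_0,v_0)\in\mathcal D$, let $p_0\in\mathbb E^4_2$, and let $\{x_0,y_0,(n_1)_0,(n_2)_0\}$ be an orthonormal frame at $p_0$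 with $\langle x_0,x_0\rangle=1$, $\langle y_0,y_0\rangle=-1$, $\langle (n_1)_0,(n_1)_0\rangle=\varepsilon$, $\langle (n_2)_0,(n_2)_0\rangle=-\varepsilon$. Then there are a subdomain $\mathcal D_0\subset\mathcal D$ containing $(u_0,v_0)$ and a unique minimal Lorentz surface of general type $z=z(u,v)$, $(u,v)\in\mathcal D_0$, in isothermal parameters along the canonical directions, such that $z(u_0,v_0)=p_0$ and such that some geometric frame field of $z$ with sign $\varepsilon$ has the geometric functions $\mu(u,v),\nu(u,v)$ and equals $\{x_0,y_0,(n_1)_0,(n_2)_0\}$ at $(u_0,v_0)$; the field appearing in $z_u=f\,x$, $z_v=f\,y$ is this one. Furthermore, $(u,v)$ are canonical parameters of this surface. (2) On any subdomain $\mathcal D_1\subset\mathcal D$, any two minimal Lorentz surfaces of general type $z_1,z_2$, in isothermal parameters along the canonical directions and with geometric functions $\mu(u,v),\nu(u,v)$ (each with its own sign $\pm1$ of $\langle n_1,n_1\rangle$), differ by a rigid motion: $z_2=T\circ z_1$ on $\mathcal D_1$ for an affine transformation $T$ of $\mathbb E^4_2$ whose linear part preserves $\langle\cdot,\cdot\rangle$.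 -/

import Mathlib

open Set
open scoped ContDiff

noncomputable section

namespace BonnetLorentz

/-- The underlying vector space of the pseudo-Euclidean space of dimension four and index two.
The metric is `ip`; the norm of `Fin 4 → ℝ` only serves as a source of the usual topology and
smooth structure. -/
abbrev E42 : Type := Fin 4 → ℝ

/-- The indefinite scalar product `dx₁² + dx₂² - dx₃² - dx₄²`. -/
def ip (v w : E42) : ℝ := v 0 * w 0 + v 1 * w 1 - v 2 * w 2 - v 3 * w 3

/-! ### Calculus in the parameter plane with coordinates `(u, v)` -/

/-- The partial derivative with respect to `u`. -/
def du {F : Type*} [NormedAddCommGroup F] [NormedSpace ℝ F] (h : ℝ × ℝ → F) (p : ℝ × ℝ) : F :=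
  fderiv ℝ h p (1, 0)

/-- The partial derivative with respect to `v`. -/
def dv {F : Type*} [NormedAddCommGroup F] [NormedSpace ℝ F] (h : ℝ × ℝ → F) (p : ℝ × ℝ) : F :=
  fderiv ℝ h p (0, 1)

/-- The hyperbolic Laplace operator `∂²/∂u² - ∂²/∂v²`. -/
def hypLaplacian (h : ℝ × ℝ → ℝ) (p : ℝ × ℝ) : ℝ := du (du h) p - dv (dv h) p

/-! ### First fundamental form, tangent and normal spaces of `z = z(u, v)` -/

def coeffE (z : ℝ × ℝ → E42) (p : ℝ × ℝ) : ℝ := ip (du z p) (du z p)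

def coeffF (z : ℝ × ℝ → E42) (p : ℝ × ℝ) : ℝ := ip (du z p) (dv z p)

def coeffG (z : ℝ × ℝ → E42) (p : ℝ × ℝ) : ℝ := ip (dv z p) (dv z p)

/-- The determinant `E G - F²` of the first fundamental form. -/
def gram (z : ℝ × ℝ → E42) (p : ℝ × ℝ) : ℝ := coeffE z p * coeffG z p - coeffF z p ^ 2

def tangentPlane (z : ℝ × ℝ → E42) (p : ℝ × ℝ) : Submodule ℝ E42 :=
  Submodule.span ℝ {du z p, dv z p}

/-- The orthogonal complement of the tangent plane. -/
def normalPlane (z : ℝ × ℝ → E42) (p : ℝ × ℝ) : Submodule ℝ E42 where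
  carrier := {w | ip w (du z p) = 0 ∧ ip w (dv z p) = 0}
  add_mem' := by
    rintro a b ⟨ha, ha'⟩ ⟨hb, hb'⟩
    simp only [ip, mem_ofPred_eq, Pi.add_apply] at *
    constructor <;> linarith
  zero_mem' := by simp [ip]
  smul_mem' := by
    rintro c a ⟨ha, ha'⟩
    simp only [ip, mem_ofPred_eq, Pi.smul_apply, smul_eq_mul] at *
    exact ⟨by linear_combination c * ha, by linear_combination c * ha'⟩

/-- `(a, b)` is a basis of the plane `W` with `⟨a, a⟩ = 1`, `⟨b, b⟩ = -1`, `⟨a, b⟩ = 0`. -/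
def IsLorentzBasis (W : Submodule ℝ E42) (a b : E42) : Prop :=
  Submodule.span ℝ {a, b} = W ∧ ip a a = 1 ∧ ip b b = -1 ∧ ip a b = 0

/-- The metric has signature `(1, 1)` on `W`. -/
def HasLorentzSignature (W : Submodule ℝ E42) : Prop := ∃ a b : E42, IsLorentzBasis W a b

/-- `z` is a Lorentz (in particular immersed) surface at the parameter value `p`. -/
def IsLorentzAt (z : ℝ × ℝ → E42) (p : ℝ × ℝ) : Prop :=
  IsCompl (tangentPlane z p) (normalPlane z p) ∧
    HasLorentzSignature (tangentPlane z p) ∧ HasLorentzSignature (normalPlane z p)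

/-- The coordinates, with respect to `(z_u, z_v)`, of the orthogonal projection of `w` to the
tangent plane. -/
def tangentCoords (z : ℝ × ℝ → E42) (p : ℝ × ℝ) (w : E42) : ℝ × ℝ :=
  ((coeffG z p * ip w (du z p) - coeffF z p * ip w (dv z p)) / gram z p,
    (coeffE z p * ip w (dv z p) - coeffF z p * ip w (du z p)) / gram z p)

/-- The orthogonal projection of `w` to the normal plane. -/
def normalPart (z : ℝ × ℝ → E42) (p : ℝ × ℝ) (w : E42) : E42 :=
  w - ((tangentCoords z p w).1 • du z p + (tangentCoords z p w).2 • dv z p)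

/-! ### Second fundamental form and curvatures -/

/-- The second fundamental form `σ(a, b)` of tangent vectors `a = dz(X)`, `b = dz(Y)`: the normal
component of the second derivative `D²z(X, Y)`. -/
def secondForm (z : ℝ × ℝ → E42) (p : ℝ × ℝ) (a b : E42) : E42 :=
  normalPart z p
    (fderiv ℝ (fun q => fderiv ℝ z q (tangentCoords z p b)) p (tangentCoords z p a))

/-- The mean curvature vector: half of the metric trace of the second fundamental form. -/
def meanCurvature (z : ℝ × ℝ → E42) (p : ℝ × ℝ) : E42 :=
  (1 / 2 : ℝ) • ((1 / gram z p) •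
    (coeffG z p • secondForm z p (du z p) (du z p)
      - (2 * coeffF z p) • secondForm z p (du z p) (dv z p)
      + coeffE z p • secondForm z p (dv z p) (dv z p)))

/-- The span of all the values of the second fundamental form at `p`. -/
def firstNormalSpace (z : ℝ × ℝ → E42) (p : ℝ × ℝ) : Submodule ℝ E42 :=
  Submodule.span ℝ {w | ∃ a ∈ tangentPlane z p, ∃ b ∈ tangentPlane z p, w = secondForm z p a b}

/-- The Gauss curvature. -/
def gaussCurvature (z : ℝ × ℝ → E42) (p : ℝ × ℝ) : ℝ :=
  (ip (secondForm z p (du z p) (du z p)) (secondForm z p (dv z p) (dv z p))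
    - ip (secondForm z p (du z p) (dv z p)) (secondForm z p (du z p) (dv z p))) / gram z p

/-- The normal connection `D` in the direction `∂/∂u`. -/
def normalDu (z : ℝ × ℝ → E42) (ξ : ℝ × ℝ → E42) (p : ℝ × ℝ) : E42 := normalPart z p (du ξ p)

/-- The normal connection `D` in the direction `∂/∂v`. -/
def normalDv (z : ℝ × ℝ → E42) (ξ : ℝ × ℝ → E42) (p : ℝ × ℝ) : E42 := normalPart z p (dv ξ p)

/-- The curvature `R^⊥(a, b) ξ` of the normal connection, for tangent vectors `a`, `b` at `p` and a
normal field `ξ`; it is bilinear and alternating in `(a, b)`, and the bracket of the coordinate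
fields `∂/∂u`, `∂/∂v` vanishes. -/
def normalCurvatureTensor (z : ℝ × ℝ → E42) (p : ℝ × ℝ) (a b : E42) (ξ : ℝ × ℝ → E42) : E42 :=
  ((tangentCoords z p a).1 * (tangentCoords z p b).2
      - (tangentCoords z p a).2 * (tangentCoords z p b).1) •
    (normalDu z (normalDv z ξ) p - normalDv z (normalDu z ξ) p)

/-- The normal curvature with respect to an orthonormal tangent basis `(a, b)` at `p` and an
orthonormal normal frame field `(e₁, e₂)` near `p`. A change of these frames affects only the
sign. -/
def normalCurvature (z : ℝ × ℝ → E42) (p : ℝ × ℝ) (a b : E42) (e₁ e₂ : ℝ × ℝ → E42) : ℝ :=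
  ip (normalCurvatureTensor z p a b e₁) (e₂ p) / (ip a a * ip b b - ip a b ^ 2)

/-- The inequality `K² - ϰ² > 0` at `p`. -/
def HasPositiveDiscriminant (z : ℝ × ℝ → E42) (p : ℝ × ℝ) : Prop :=
  ∃ (a b : E42) (V : Set (ℝ × ℝ)) (e₁ e₂ : ℝ × ℝ → E42),
    IsLorentzBasis (tangentPlane z p) a b ∧
    IsOpen V ∧ p ∈ V ∧ ContDiffOn ℝ ∞ e₁ V ∧ ContDiffOn ℝ ∞ e₂ V ∧
    (∀ q ∈ V, IsLorentzBasis (normalPlane z q) (e₁ q) (e₂ q)) ∧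
    0 < gaussCurvature z p ^ 2 - normalCurvature z p a b e₁ e₂ ^ 2

/-- `z = z(u, v)`, `(u, v) ∈ D`, is a minimal Lorentz surface of general type. -/
structure IsMinimalLorentzOfGeneralType (z : ℝ × ℝ → E42) (D : Set (ℝ × ℝ)) : Prop where
  smooth : ContDiffOn ℝ ∞ z D
  lorentz : ∀ p ∈ D, IsLorentzAt z p
  minimal : ∀ p ∈ D, meanCurvature z p = 0
  two_dim : ∀ p ∈ D, Module.finrank ℝ (firstNormalSpace z p) = 2
  general : ∃ U ⊆ D, IsOpen U ∧ D ⊆ closure U ∧ ∀ p ∈ U, HasPositiveDiscriminant z p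

/-! ### Geometric frames and canonical parameters -/

/-- An orthonormal frame with `⟨x, x⟩ = 1`, `⟨y, y⟩ = -1`, `⟨n₁, n₁⟩ = ε`, `⟨n₂, n₂⟩ = -ε`. -/
structure IsOrthonormalFrame (ε : ℝ) (x y n₁ n₂ : E42) : Prop where
  xx : ip x x = 1
  yy : ip y y = -1
  n₁n₁ : ip n₁ n₁ = ε
  n₂n₂ : ip n₂ n₂ = -ε
  xy : ip x y = 0
  xn₁ : ip x n₁ = 0
  xn₂ : ip x n₂ = 0
  yn₁ : ip y n₁ = 0
  yn₂ : ip y n₂ = 0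
  n₁n₂ : ip n₁ n₂ = 0

/-- `(x, y, n₁, n₂)` is a geometric frame field of `z` on `D`, and `μ`, `ν` are the corresponding
geometric functions. -/
structure IsGeometricFrame (z : ℝ × ℝ → E42) (D : Set (ℝ × ℝ)) (ε : ℝ) (μ ν : ℝ × ℝ → ℝ)
    (x y n₁ n₂ : ℝ × ℝ → E42) : Prop where
  smooth_x : ContDiffOn ℝ ∞ x D
  smooth_y : ContDiffOn ℝ ∞ y D
  smooth_n₁ : ContDiffOn ℝ ∞ n₁ D
  smooth_n₂ : ContDiffOn ℝ ∞ n₂ D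
  tangent_x : ∀ p ∈ D, x p ∈ tangentPlane z p
  tangent_y : ∀ p ∈ D, y p ∈ tangentPlane z p
  normal_n₁ : ∀ p ∈ D, n₁ p ∈ normalPlane z p
  normal_n₂ : ∀ p ∈ D, n₂ p ∈ normalPlane z p
  orthonormal : ∀ p ∈ D, IsOrthonormalFrame ε (x p) (y p) (n₁ p) (n₂ p)
  sigma_xx : ∀ p ∈ D, secondForm z p (x p) (x p) = ν p • n₁ p
  sigma_xy : ∀ p ∈ D, secondForm z p (x p) (y p) = μ p • n₂ p
  sigma_yy : ∀ p ∈ D, secondForm z p (y p) (y p) = ν p • n₁ p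
  mul_ne_zero : ∀ p ∈ D, μ p * ν p ≠ 0

/-- `(u, v)` are isothermal parameters of `z` on `D` whose coordinate directions are those of the
fields `x`, `y`: `x = z_u / f` and `y = z_v / f` for a positive function `f`. -/
def IsIsothermalAlong (z : ℝ × ℝ → E42) (D : Set (ℝ × ℝ)) (x y : ℝ × ℝ → E42) : Prop :=
  ∃ f : ℝ × ℝ → ℝ, ∀ p ∈ D, 0 < f p ∧ du z p = f p • x p ∧ dv z p = f p • y p

/-- `E = -G = 1 / √|μ² - ν²|` and `F = 0`. -/
def IsCanonical (z : ℝ × ℝ → E42) (D : Set (ℝ × ℝ)) (μ ν : ℝ × ℝ → ℝ) : Prop :=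
  ∀ p ∈ D, coeffE z p = 1 / √|μ p ^ 2 - ν p ^ 2| ∧ coeffF z p = 0 ∧
    coeffG z p = -(1 / √|μ p ^ 2 - ν p ^ 2|)

/-- `z` is a minimal Lorentz surface of general type on `D`, with geometric functions `μ`, `ν`, in
isothermal parameters along the canonical directions; it passes through `p₀` at the parameter value
`w₀`, where its geometric frame is `(x₀, y₀, m₁, m₂)`. -/
def IsSurfaceThrough (z : ℝ × ℝ → E42) (D : Set (ℝ × ℝ)) (ε : ℝ) (μ ν : ℝ × ℝ → ℝ)
    (w₀ : ℝ × ℝ) (p₀ x₀ y₀ m₁ m₂ : E42) : Prop :=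
  IsMinimalLorentzOfGeneralType z D ∧ z w₀ = p₀ ∧
    ∃ x y n₁ n₂ : ℝ × ℝ → E42,
      IsGeometricFrame z D ε μ ν x y n₁ n₂ ∧ IsIsothermalAlong z D x y ∧
        x w₀ = x₀ ∧ y w₀ = y₀ ∧ n₁ w₀ = m₁ ∧ n₂ w₀ = m₂

/-- `z` is a minimal Lorentz surface of general type on `D`, with geometric functions `μ`, `ν`, in
isothermal parameters along the canonical directions. -/
def IsSurfaceWithInvariants (z : ℝ × ℝ → E42) (D : Set (ℝ × ℝ)) (μ ν : ℝ × ℝ → ℝ) : Prop :=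
  IsMinimalLorentzOfGeneralType z D ∧
    ∃ ε : ℝ, (ε = 1 ∨ ε = -1) ∧ ∃ x y n₁ n₂ : ℝ × ℝ → E42,
      IsGeometricFrame z D ε μ ν x y n₁ n₂ ∧ IsIsothermalAlong z D x y

/-- A rigid motion: an affine transformation whose linear part preserves the scalar product. -/
def IsRigidMotion (T : E42 → E42) : Prop :=
  ∃ (A : E42 ≃ₗ[ℝ] E42) (b : E42), (∀ v w, ip (A v) (A w) = ip v w) ∧ ∀ v, T v = A v + b

end BonnetLorentz

end

/-! This is a Bonnet theorem proved by moving frames; the point special to minimal surfaces of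
general type is that μ and ν alone determine every coefficient of the structure equations. Along z_u
= f x, z_v = f y, a geometric frame satisfies a linear system (`FrameEquations`) whose coefficients
are f, the tangential connection coefficients a, b, the functions N = f ν and M = f μ, and the
normal connection coefficients B₁, B₂.

Rigidity: symmetry of z_uv gives a = f_v / f and b = f_u / f. Symmetry of the second derivatives of
x and y gives the Gauss and Codazzi equations (`IsFramedSurface.gauss_codazzi`). Eliminating B₁, B₂
from Codazzi yields d ln f = -¼ d ln|μ² - ν²|, so f is |μ² - ν²|^(-1/4) up to a locally constant
factor. Comparison of the Gauss equation with the first natural equation shows that this factor is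
1, so the parameters are canonical, and that the sign of the frame is ε. Codazzi then gives (B₂, B₁)
as half the gradient of ln|(μ + ν)/(μ - ν)|. Thus all surfaces in question obey one and the same
linear system (`canonicalFrameEquations_of_isGeometricFrame`), and the linear map carrying one frame
to the other is constant (`framePairing_const`, `eq_frameMap_of_frameEquations`).

Existence: for the coefficients just found the Codazzi equations are identities, while the two
natural equations are exactly Gauss and Ricci (`integrable_canonical`). The system is therefore
flat, and the linear Frobenius theorem (`exists_parallel`) solves it near the base point
(`exists_framedSurface`). Orthonormality propagates from the initial frame, and the remaining
properties are read off from the frame equations; in particular K² - ϰ² = (μ² - ν²)². -/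

namespace BonnetLorentz

/-! ### Linear differential equations and the Frobenius theorem -/

open Filter Topology Metric in
/-- A linear ordinary differential equation with coefficient of norm at most `1 / 2` has a solution
on the unit interval for every initial value. -/
theorem exists_linear_ode {V : Type*} [NormedAddCommGroup V] [NormedSpace ℝ V] [CompleteSpace V]
    (A : ℝ → V →L[ℝ] V) (hA : ContinuousOn A (Icc 0 1)) (hb : ∀ t ∈ Icc (0 : ℝ) 1, ‖A t‖ ≤ 1 / 2)
    (c : V) :
    ∃ α : ℝ → V, α 0 = c ∧
      (∀ t ∈ Icc (0 : ℝ) 1, HasDerivWithinAt α (A t (α t)) (Icc 0 1) t) ∧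
      ∀ t ∈ Icc (0 : ℝ) 1, ‖α t‖ ≤ ‖c‖ * Real.exp 1 := by
  -- On the ball of radius ‖c‖ about c one has ‖x‖ ≤ 2‖c‖, hence ‖A t x‖ ≤ ‖c‖. In unit time a
  -- solution cannot leave the ball; the bound 1/2 on the coefficient makes one Picard step cover
  -- the whole interval.
  have hP : IsPicardLindelof (fun t x => A t x) (tmin := 0) (tmax := 1)
      ⟨0, by norm_num, by norm_num⟩ c ‖c‖₊ 0 ‖c‖₊ (1 / 2) := by
    refine ⟨fun t ht => ?_, fun x _ => hA.clm_apply continuousOn_const, fun t ht x hx => ?_, ?_⟩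
    · refine ((A t).lipschitz.weaken ?_).lipschitzOnWith
      rw [← NNReal.coe_le_coe]
      simpa using hb t ht
    · have h1 : ‖x‖ ≤ 2 * ‖c‖ := by
        have h3 : ‖x - c‖ ≤ ‖c‖ := by simpa [dist_eq_norm] using hx
        linarith [norm_add_le (x - c) c, congrArg norm (sub_add_cancel x c)]
      calc ‖A t x‖ ≤ ‖A t‖ * ‖x‖ := (A t).le_opNorm x
        _ ≤ 1 / 2 * (2 * ‖c‖) := by gcongr; exact hb t ht
        _ = ‖c‖ := by ring
    · simp
  obtain ⟨α, h0, hα⟩ := hP.exists_eq_forall_mem_Icc_hasDerivWithinAt₀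
  refine ⟨α, h0, hα, fun t ht => ?_⟩
  have hG := norm_le_gronwallBound_of_norm_deriv_right_le (f := α) (f' := fun t => A t (α t))
    (δ := ‖c‖) (K := 1 / 2) (ε := 0) (a := 0) (b := 1)
    (fun s hs => (hα s hs).continuousWithinAt)
    (fun s hs => (hα s (Ico_subset_Icc_self hs)).mono_of_mem_nhdsWithin (Icc_mem_nhdsGE_of_mem hs))
    (by simp at h0; simp [h0])
    (fun s hs => by
      have := (A s).le_opNorm (α s)
      have h2 := mul_le_mul_of_nonneg_right (hb s (Ico_subset_Icc_self hs)) (norm_nonneg (α s))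
      linarith) t ht
  rw [gronwallBound_ε0] at hG
  refine hG.trans ?_
  gcongr
  linarith [ht.2, ht.1]

set_option maxSynthPendingDepth 3 in
open Filter Topology Metric in
/-- The Frobenius theorem for linear total differential systems `dφ(h) = Ω(h) φ`: if the connection
form `Ω` is flat, there are local solutions with every initial value. -/
theorem exists_parallel {E V : Type*} [NormedAddCommGroup E] [NormedSpace ℝ E]
    [NormedAddCommGroup V] [NormedSpace ℝ V] [CompleteSpace V]
    (Ω : E → E →L[ℝ] V →L[ℝ] V) {U : Set E} (hU : IsOpen U) {w : E} (hw : w ∈ U)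
    (hΩ : ContDiffOn ℝ ∞ Ω U)
    (hflat : ∀ p ∈ U, ∀ h k x, fderiv ℝ Ω p h k x + Ω p k (Ω p h x)
      = fderiv ℝ Ω p k h x + Ω p h (Ω p k x)) :
    ∃ r > 0, ball w r ⊆ U ∧ ∀ c : V, ∃ φ : E → V, ContDiffOn ℝ ∞ φ (ball w r) ∧ φ w = c ∧
      ∀ p ∈ ball w r, HasFDerivAt φ ((Ω p).flip (φ p)) p := by
  have hdΩ : ContDiffOn ℝ ∞ (fderiv ℝ Ω) U := hΩ.fderiv_of_isOpen hU (by simp)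
  have hUw : U ∈ 𝓝 w := hU.mem_nhds hw
  obtain ⟨C, s, hs, hC⟩ :=
    ((hdΩ.contDiffAt hUw).of_le (m := 1) (by norm_cast)).exists_lipschitzOnWith
  have hK : ∀ᶠ p in 𝓝 w, ‖Ω p‖ < ‖Ω w‖ + 1 :=
    ((hΩ.continuousOn.continuousAt hUw).norm).eventually_lt_const (by linarith)
  have hK' : ∀ᶠ p in 𝓝 w, ‖fderiv ℝ Ω p‖ < ‖fderiv ℝ Ω w‖ + 1 :=
    ((hdΩ.continuousOn.continuousAt hUw).norm).eventually_lt_const (by linarith)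
  set K := ‖Ω w‖ + 1 with hKdef
  set K' := ‖fderiv ℝ Ω w‖ + 1 with hK'def
  have hK0 : 0 < K := by positivity
  have hK'0 : 0 < K' := by positivity
  obtain ⟨r₀, hr₀, hball⟩ := Metric.eventually_nhds_iff_ball.1
    ((hK.and hK').and ((show ∀ᶠ p in 𝓝 w, p ∈ s from hs).and (hU.eventually_mem hw)))
  have hbΩ : ∀ p ∈ ball w r₀, ‖Ω p‖ ≤ K := fun p hp => (hball p hp).1.1.le
  have hbdΩ : ∀ p ∈ ball w r₀, ‖fderiv ℝ Ω p‖ ≤ K' := fun p hp => (hball p hp).1.2.le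
  have hbU : ∀ p ∈ ball w r₀, p ∈ U := fun p hp => (hball p hp).2.2
  have hbs : ∀ p ∈ ball w r₀, p ∈ s := fun p hp => (hball p hp).2.1
  -- The condition K r ≤ 1/2 makes `exists_linear_ode` applicable along every ray from w. The radius
  -- does not depend on the initial value, so one ball serves several solutions at once.
  obtain ⟨r, hr, hrr₀, hr1, hrK⟩ : ∃ r > 0, r ≤ r₀ ∧ r ≤ 1 ∧ K * r ≤ 1 / 2 := by
    refine ⟨min r₀ (min 1 (1 / (2 * K))), by positivity, min_le_left _ _,
      (min_le_right _ _).trans (min_le_left _ _), ?_⟩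
    calc K * min r₀ (min 1 (1 / (2 * K))) ≤ K * (1 / (2 * K)) := by
          gcongr; exact (min_le_right _ _).trans (min_le_right _ _)
      _ = 1 / 2 := by field_simp
  have hsub : ball w r ⊆ ball w r₀ := ball_subset_ball hrr₀
  have hdif : ∀ p ∈ U, HasFDerivAt Ω (fderiv ℝ Ω p) p := fun p hp =>
    ((hΩ.contDiffAt (hU.mem_nhds hp)).differentiableAt (by simp)).hasFDerivAt
  -- Lipschitz and Taylor estimates
  have hlip : ∀ p ∈ ball w r₀, ∀ q ∈ ball w r₀, ‖Ω q - Ω p‖ ≤ K' * ‖q - p‖ := fun p hp q hq =>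
    (convex_ball w r₀).norm_image_sub_le_of_norm_hasFDerivWithin_le
      (fun x hx => (hdif x (hbU x hx)).hasFDerivWithinAt) hbdΩ hp hq
  have htay : ∀ p ∈ ball w r₀, ∀ q ∈ ball w r₀,
      ‖Ω q - Ω p - fderiv ℝ Ω p (q - p)‖ ≤ C * ‖q - p‖ * ‖q - p‖ := by
    intro p hp q hq
    refine ((convex_ball w r₀).segment_subset hp hq |> fun hseg =>
      (convex_segment p q).norm_image_sub_le_of_norm_hasFDerivWithin_le'
      (fun x hx => (hdif x (hbU x (hseg hx))).hasFDerivWithinAt) (fun x hx => ?_)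
      (left_mem_segment ℝ p q) (right_mem_segment ℝ p q))
    have h1 := hC.norm_sub_le (hbs x (hseg hx)) (hbs p hp)
    refine h1.trans ?_
    gcongr
    simpa using norm_sub_le_of_mem_segment hx
  have hray : ∀ h : E, ‖h‖ < r → ∀ t ∈ Icc (0 : ℝ) 1, w + t • h ∈ ball w r := by
    intro h hh t ht
    rw [mem_ball, dist_eq_norm, add_sub_cancel_left, norm_smul, Real.norm_of_nonneg ht.1]
    nlinarith [ht.2, norm_nonneg h]
  refine ⟨r, hr, fun p hp => hbU p (hsub hp), fun c => ?_⟩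
  -- A solution is forced along rays, so the equation is solved on t ↦ w + t h for each h. The value
  -- at time 1 will be φ (w + h).
  have hex : ∀ h : E, ∃ α : ℝ → V, ‖h‖ < r → α 0 = c ∧
      (∀ t ∈ Icc (0 : ℝ) 1, HasDerivWithinAt α (Ω (w + t • h) h (α t)) (Icc 0 1) t) ∧
      ∀ t ∈ Icc (0 : ℝ) 1, ‖α t‖ ≤ ‖c‖ * Real.exp 1 := by
    intro h
    by_cases hh : ‖h‖ < r
    · have hcont : ContinuousOn (fun t : ℝ => Ω (w + t • h) h) (Icc 0 1) :=
        (hΩ.continuousOn.comp (by fun_prop) fun t ht => hbU _ (hsub (hray h hh t ht))).clm_apply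
          continuousOn_const
      have hnorm : ∀ t ∈ Icc (0 : ℝ) 1, ‖Ω (w + t • h) h‖ ≤ 1 / 2 := fun t ht =>
        calc ‖Ω (w + t • h) h‖ ≤ ‖Ω (w + t • h)‖ * ‖h‖ := (Ω _).le_opNorm h
          _ ≤ K * r := by gcongr; exact hbΩ _ (hsub (hray h hh t ht))
          _ ≤ 1 / 2 := hrK
      obtain ⟨α, h1⟩ := exists_linear_ode _ hcont hnorm c
      exact ⟨α, fun _ => h1⟩
    · exact ⟨0, fun h' => absurd h' hh⟩
  choose α hα using hex
  set Y := ‖c‖ * Real.exp 1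
  set M := (C + K' + (K' + K) * K) * Y with hM
  -- This quadratic estimate is differentiability of φ with the prescribed derivative. The remainder
  -- R compares two neighbouring rays; at time t their points are t k apart, which explains the
  -- factor t in the linear term. Grönwall applies to R because R' is bounded by ½‖R‖ plus a term
  -- quadratic in k.
  have key : ∀ h k : E, ‖h‖ < r → ‖h + k‖ < r →
      ‖α (h + k) 1 - α h 1 - Ω (w + h) k (α h 1)‖ ≤
        2 * (Real.exp (1 / 2) - 1) * M * ‖k‖ ^ 2 := by
    intro h k hh hk
    obtain ⟨h0, hd, hbd⟩ := hα h hh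
    obtain ⟨h0', hd', hbd'⟩ := hα (h + k) hk
    let R : ℝ → V := fun t => α (h + k) t - α h t - t • Ω (w + t • h) k (α h t)
    let R' : ℝ → V := fun t => Ω (w + t • (h + k)) (h + k) (α (h + k) t) - Ω (w + t • h) h (α h t)
      - (t • (fderiv ℝ Ω (w + t • h) h k (α h t) + Ω (w + t • h) k (Ω (w + t • h) h (α h t)))
        + (1 : ℝ) • Ω (w + t • h) k (α h t))
    have hR : ∀ t ∈ Icc (0 : ℝ) 1, HasDerivWithinAt R (R' t) (Icc 0 1) t := by
      intro t ht
      have hline : HasDerivAt (fun t : ℝ => w + t • h) h t := by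
        simpa using ((hasDerivAt_id t).smul_const h).const_add w
      have h1 := (hdif _ (hbU _ (hsub (hray h hh t ht)))).comp_hasDerivAt t hline
      have h2 := (h1.clm_apply (hasDerivAt_const t k)).hasDerivWithinAt (s := Icc 0 1)
      have h3 := h2.clm_apply (hd t ht)
      have h4 := (hasDerivWithinAt_id t (Icc (0:ℝ) 1)).smul h3
      refine (((hd' t ht).sub (hd t ht)).sub h4).congr_deriv ?_
      simp [R']
    have hbound : ∀ t ∈ Icc (0 : ℝ) 1, ‖R' t‖ ≤ 1 / 2 * ‖R t‖ + M * ‖k‖ ^ 2 := by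
      intro t ht
      set q := w + t • h with hq
      set q' := w + t • (h + k) with hq'
      have hqr := hsub (hray h hh t ht)
      have hqr' := hsub (hray (h + k) hk t ht)
      have hqq : q' - q = t • k := by rw [hq, hq', smul_add]; abel
      set y := α h t with hy
      have hyY : ‖y‖ ≤ Y := hbd t ht
      have ht1 : |t| ≤ 1 := abs_le.2 ⟨by linarith [ht.1], ht.2⟩
      -- Flatness enters only here: it exchanges h and k in the derivative of Ω, so that the
      -- first-order terms combine into a Taylor remainder of Ω in the direction t k. Everything
      -- outside the R-term is then of second order in k.
      have hid : R' t = Ω q' (h + k) (R t) + (Ω q' - Ω q - fderiv ℝ Ω q (q' - q)) (h + k) y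
          + t • fderiv ℝ Ω q k k y
          + t • ((Ω q' - Ω q) (h + k) (Ω q k y) + Ω q k (Ω q k y)) := by
        simp only [R', R, hflat q (hbU q hqr) h k y, hqq, ← hq, ← hq', ← hy]
        simp only [map_add, map_sub, map_smul, _root_.sub_apply,
          _root_.add_apply, _root_.smul_apply, smul_add, smul_sub,
          one_smul]
        abel
      have hhk1 : ‖h + k‖ ≤ 1 := hk.le.trans hr1
      have hk' : ‖q' - q‖ ≤ ‖k‖ := by
        rw [hqq, norm_smul]
        exact mul_le_of_le_one_left (norm_nonneg _) ht1
      have b1 : ‖Ω q' (h + k) (R t)‖ ≤ 1 / 2 * ‖R t‖ := by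
        calc _ ≤ ‖Ω q'‖ * ‖h + k‖ * ‖R t‖ := (Ω q').le_opNorm₂ _ _
          _ ≤ K * r * ‖R t‖ := by gcongr; exact hbΩ _ hqr'
          _ ≤ _ := by gcongr
      have b2 : ‖(Ω q' - Ω q - fderiv ℝ Ω q (q' - q)) (h + k) y‖ ≤ C * ‖k‖ ^ 2 * Y := by
        calc _ ≤ ‖Ω q' - Ω q - fderiv ℝ Ω q (q' - q)‖ * ‖h + k‖ * ‖y‖ :=
              ContinuousLinearMap.le_opNorm₂ _ _ _
          _ ≤ (C * ‖q' - q‖ * ‖q' - q‖) * 1 * Y := by gcongr; exact htay q hqr q' hqr'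
          _ ≤ (C * ‖k‖ * ‖k‖) * 1 * Y := by gcongr
          _ = _ := by ring
      have hΩk : ‖Ω q k y‖ ≤ K * ‖k‖ * Y := by
        calc _ ≤ ‖Ω q‖ * ‖k‖ * ‖y‖ := (Ω q).le_opNorm₂ _ _
          _ ≤ _ := by gcongr; exact hbΩ _ hqr
      have b3 : ‖t • fderiv ℝ Ω q k k y‖ ≤ K' * ‖k‖ ^ 2 * Y := by
        rw [norm_smul]
        calc _ ≤ 1 * (‖fderiv ℝ Ω q k‖ * ‖k‖ * ‖y‖) := by
              gcongr
              · exact ht1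
              · exact ContinuousLinearMap.le_opNorm₂ _ _ _
          _ ≤ 1 * ((K' * ‖k‖) * ‖k‖ * Y) := by
              gcongr
              exact (ContinuousLinearMap.le_opNorm _ _).trans (by gcongr; exact hbdΩ _ hqr)
          _ = _ := by ring
      have b4 : ‖t • ((Ω q' - Ω q) (h + k) (Ω q k y) + Ω q k (Ω q k y))‖
          ≤ (K' + K) * K * ‖k‖ ^ 2 * Y := by
        rw [norm_smul]
        calc _ ≤ 1 * ((K' * ‖k‖) * 1 * (K * ‖k‖ * Y) + K * ‖k‖ * (K * ‖k‖ * Y)) := by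
              gcongr
              · exact ht1
              · refine (norm_add_le _ _).trans (add_le_add ?_ ?_)
                · refine (ContinuousLinearMap.le_opNorm₂ _ _ _).trans ?_
                  gcongr
                  exact (hlip q hqr q' hqr').trans (by gcongr)
                · refine (ContinuousLinearMap.le_opNorm₂ _ _ _).trans ?_
                  gcongr
                  exact hbΩ _ hqr
          _ = _ := by ring
      rw [hid]
      calc _ ≤ 1 / 2 * ‖R t‖ + C * ‖k‖ ^ 2 * Y + K' * ‖k‖ ^ 2 * Y
            + (K' + K) * K * ‖k‖ ^ 2 * Y :=
            (norm_add₃_le.trans (add_le_add (add_le_add (norm_add_le_of_le b1 b2) b3) b4))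
        _ = _ := by rw [hM]; ring
    have hG := norm_le_gronwallBound_of_norm_deriv_right_le (f := R) (f' := R')
      (δ := 0) (K := 1 / 2) (ε := M * ‖k‖ ^ 2) (a := 0) (b := 1)
      (fun t ht => (hR t ht).continuousWithinAt)
      (fun t ht => (hR t (Ico_subset_Icc_self ht)).mono_of_mem_nhdsWithin
        (Icc_mem_nhdsGE_of_mem ht))
      (by simp [R, h0, h0']) (fun t ht => hbound t (Ico_subset_Icc_self ht)) 1 (by simp)
    rw [gronwallBound_of_K_ne_0 (by norm_num)] at hG
    simp only [R, one_smul] at hG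
    refine hG.trans (le_of_eq ?_)
    norm_num
    ring
  let φ : E → V := fun p => α (p - w) 1
  have hφd : ∀ p ∈ ball w r, HasFDerivAt φ ((Ω p).flip (φ p)) p := by
    intro p hp
    rw [hasFDerivAt_iff_isLittleO_nhds_zero]
    have hpw : ‖p - w‖ < r := by simpa [dist_eq_norm] using hp
    have hev : ∀ᶠ k in 𝓝 (0 : E), ‖p - w + k‖ < r :=
      (Continuous.tendsto' (by fun_prop) 0 ‖p - w‖ (by simp)).eventually_lt_const hpw
    refine Asymptotics.IsBigO.trans_isLittleO (g := fun k => ‖k‖ ^ 2) ?_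
      (Asymptotics.isLittleO_norm_pow_id one_lt_two)
    refine Asymptotics.IsBigO.of_bound (2 * (Real.exp (1 / 2) - 1) * M) ?_
    filter_upwards [hev] with k hk
    have := key (p - w) k hpw hk
    simp only [add_sub_cancel] at this
    simpa [φ, add_sub_right_comm] using this
  refine ⟨φ, ?_, ?_, hφd⟩
  -- Bootstrapping: the derivative of φ is linear in φ with smooth coefficients, so C^n implies
  -- C^(n+1).
  · rw [contDiffOn_infty]
    intro n
    induction n with
    | zero =>
      exact contDiffOn_zero.2 fun p hp => (hφd p hp).continuousAt.continuousWithinAt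
    | succ n ih =>
      push_cast
      rw [contDiffOn_succ_iff_fderiv_of_isOpen isOpen_ball]
      refine ⟨fun p hp => (hφd p hp).differentiableAt.differentiableWithinAt, by simp, ?_⟩
      have hΩn : ContDiffOn ℝ n (fun p => (Ω p).flip) (ball w r) :=
        (ContinuousLinearMap.flipₗᵢ ℝ E V V).contDiff.comp_contDiffOn
          ((hΩ.mono fun p hp => hbU p (hsub hp)).of_le (by exact_mod_cast le_top))
      exact (hΩn.clm_apply ih).congr fun p hp => (hφd p hp).fderiv
  · have h0 := hα 0 (by simpa using hr)
    obtain ⟨h1, h2, -⟩ := h0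
    have hc : ∀ t ∈ Icc (0 : ℝ) 1, α 0 t = α 0 0 := by
      refine constant_of_has_deriv_right_zero (fun t ht => (h2 t ht).continuousWithinAt)
        (fun t ht => ?_)
      simpa using (h2 t (Ico_subset_Icc_self ht)).mono_of_mem_nhdsWithin (Icc_mem_nhdsGE_of_mem ht)
    simpa [φ, h1] using hc 1 (by simp)

/-! ### The scalar product and orthonormal frames -/

theorem ip_comm (v w : E42) : ip v w = ip w v := by simp only [ip]; ring

theorem ip_add_left (u v w : E42) : ip (u + v) w = ip u w + ip v w := by
  simp only [ip, Pi.add_apply]; ring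

theorem ip_sub_left (u v w : E42) : ip (u - v) w = ip u w - ip v w := by
  simp only [ip, Pi.sub_apply]; ring

theorem ip_smul_left (c : ℝ) (v w : E42) : ip (c • v) w = c * ip v w := by
  simp only [ip, Pi.smul_apply, smul_eq_mul]; ring

theorem ip_add_right (u v w : E42) : ip u (v + w) = ip u v + ip u w := by
  simp only [ip, Pi.add_apply]; ring

theorem ip_sub_right (u v w : E42) : ip u (v - w) = ip u v - ip u w := by
  simp only [ip, Pi.sub_apply]; ring

theorem ip_smul_right (c : ℝ) (v w : E42) : ip v (c • w) = c * ip v w := by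
  simp only [ip, Pi.smul_apply, smul_eq_mul]; ring

theorem ip_zero_left (w : E42) : ip 0 w = 0 := by simp [ip]

/-- The sign vector of the metric. -/
def metricSign : Fin 4 → ℝ := ![1, 1, -1, -1]

/-- The entries of `∑ ηᵢ eᵢ' ⊗ eᵢ` for two frames, where `η = (1, -1, ε, -ε)`. -/
def framePairing (ε : ℝ) (x' y' m₁ m₂ x y n₁ n₂ : E42) : Matrix (Fin 4) (Fin 4) ℝ :=
  fun i j => x' i * x j - y' i * y j + ε * (m₁ i * n₁ j) - ε * (m₂ i * n₂ j)

/-- The linear map taking the orthonormal frame `(x, y, n₁, n₂)` to `(x', y', m₁, m₂)`. -/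
def frameMap (ε : ℝ) (x' y' m₁ m₂ x y n₁ n₂ : E42) : E42 →ₗ[ℝ] E42 :=
  (framePairing ε x' y' m₁ m₂ x y n₁ n₂ * Matrix.diagonal metricSign).toLin'

theorem frameMap_apply (ε : ℝ) (x' y' m₁ m₂ x y n₁ n₂ v : E42) :
    frameMap ε x' y' m₁ m₂ x y n₁ n₂ v =
      ip v x • x' - ip v y • y' + (ε * ip v n₁) • m₁ - (ε * ip v n₂) • m₂ := by
  ext i
  simp [frameMap, framePairing, metricSign, Matrix.mulVec, dotProduct, Fin.sum_univ_four, ip]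
  ring

/-- With the frame as the rows of X, orthonormality is X G Xᵀ = H and the pairing condition is Xᵀ H
X = G. They are equivalent because G² = H² = 1 and a one-sided inverse of a square matrix is
two-sided. The second form is a statement about the tensor that `framePairing_const` shows to be
constant. -/
theorem isOrthonormalFrame_iff_framePairing {ε : ℝ} (hε : ε = 1 ∨ ε = -1) {x y n₁ n₂ : E42} :
    IsOrthonormalFrame ε x y n₁ n₂ ↔
      framePairing ε x y n₁ n₂ x y n₁ n₂ = Matrix.diagonal metricSign := by
  have hε2 : ε * ε = 1 := by rcases hε with rfl | rfl <;> norm_num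
  let X : Matrix (Fin 4) (Fin 4) ℝ := Matrix.of ![x, y, n₁, n₂]
  let H : Matrix (Fin 4) (Fin 4) ℝ := Matrix.diagonal ![1, -1, ε, -ε]
  let G : Matrix (Fin 4) (Fin 4) ℝ := Matrix.diagonal metricSign
  have hH : H * H = 1 := by
    rw [Matrix.diagonal_mul_diagonal, ← Matrix.diagonal_one]
    congr 1; ext i; fin_cases i <;> simp [hε2]
  have hG : G * G = 1 := by
    rw [Matrix.diagonal_mul_diagonal, ← Matrix.diagonal_one]
    congr 1; ext i; fin_cases i <;> simp [metricSign]
  have h1 : framePairing ε x y n₁ n₂ x y n₁ n₂ = X.transpose * H * X := by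
    ext i j
    simp [framePairing, Matrix.mul_apply, X, H, Fin.sum_univ_four, Matrix.diagonal_apply]
    ring
  have h2 : X * G * X.transpose = H ↔ IsOrthonormalFrame ε x y n₁ n₂ := by
    have hent : ∀ i j, (X * G * X.transpose) i j = ip (X i) (X j) := by
      intro i j
      simp [Matrix.mul_apply, G, Fin.sum_univ_four, Matrix.diagonal_apply, metricSign, ip]
      ring
    constructor
    · intro h
      have h' : ∀ i j, ip (X i) (X j) = H i j := fun i j => by rw [← hent, h]
      exact ⟨h' 0 0, h' 1 1, h' 2 2, h' 3 3, h' 0 1, h' 0 2, h' 0 3, h' 1 2, h' 1 3, h' 2 3⟩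
    · rintro ⟨h00, h11, h22, h33, h01, h02, h03, h12, h13, h23⟩
      ext i j
      rw [hent]
      fin_cases i <;> fin_cases j <;>
        first
        | simpa [X, H] using ‹_›
        | (rw [ip_comm]; simpa [X, H] using ‹_›)
  rw [← h2, h1]
  constructor
  · intro h
    have h3 : X * (G * X.transpose * H) = 1 := by
      rw [← Matrix.mul_assoc, ← Matrix.mul_assoc, h, hH]
    have h4 := mul_eq_one_comm.1 h3
    calc X.transpose * H * X = G * G * (X.transpose * H * X) := by rw [hG, one_mul]
      _ = G * (G * X.transpose * H * X) := by simp only [Matrix.mul_assoc]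
      _ = _ := by rw [h4, mul_one]
  · intro h
    have h3 : (G * X.transpose * H) * X = 1 := by
      rw [Matrix.mul_assoc, Matrix.mul_assoc, ← Matrix.mul_assoc X.transpose, h, hG]
    have h4 := mul_eq_one_comm.1 h3
    calc X * G * X.transpose = X * G * X.transpose * (H * H) := by rw [hH, mul_one]
      _ = X * (G * X.transpose * H) * H := by simp only [Matrix.mul_assoc]
      _ = _ := by rw [h4, one_mul]

theorem IsOrthonormalFrame.frameMap_self {ε : ℝ} (hε : ε = 1 ∨ ε = -1) {x y n₁ n₂ : E42}
    (h : IsOrthonormalFrame ε x y n₁ n₂) (v : E42) : frameMap ε x y n₁ n₂ x y n₁ n₂ v = v := by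
  rw [frameMap, (isOrthonormalFrame_iff_framePairing hε).1 h, Matrix.diagonal_mul_diagonal]
  ext i
  fin_cases i <;> simp [metricSign, Matrix.mulVec_diagonal]

/-- The expansion of a vector with respect to an orthonormal frame. -/
theorem IsOrthonormalFrame.expansion {ε : ℝ} (hε : ε = 1 ∨ ε = -1) {x y n₁ n₂ : E42}
    (h : IsOrthonormalFrame ε x y n₁ n₂) (v : E42) :
    v = ip v x • x - ip v y • y + (ε * ip v n₁) • n₁ - (ε * ip v n₂) • n₂ := by
  rw [← frameMap_apply, h.frameMap_self hε]

/-- Two vectors with the same products with an orthonormal frame agree. -/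
theorem IsOrthonormalFrame.ext_ip {ε : ℝ} (hε : ε = 1 ∨ ε = -1) {x y n₁ n₂ : E42}
    (h : IsOrthonormalFrame ε x y n₁ n₂) {v w : E42} (h1 : ip v x = ip w x) (h2 : ip v y = ip w y)
    (h3 : ip v n₁ = ip w n₁) (h4 : ip v n₂ = ip w n₂) : v = w := by
  rw [h.expansion hε v, h.expansion hε w, h1, h2, h3, h4]

theorem IsOrthonormalFrame.frameMap_isometry {ε : ℝ} (hε : ε = 1 ∨ ε = -1)
    {x y n₁ n₂ x' y' m₁ m₂ : E42} (h : IsOrthonormalFrame ε x y n₁ n₂)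
    (h' : IsOrthonormalFrame ε x' y' m₁ m₂) (v w : E42) :
    ip (frameMap ε x' y' m₁ m₂ x y n₁ n₂ v) (frameMap ε x' y' m₁ m₂ x y n₁ n₂ w) = ip v w := by
  have hε2 : ε * ε = 1 := by rcases hε with rfl | rfl <;> norm_num
  conv_rhs => rw [h.expansion hε v]
  simp only [frameMap_apply, ip_add_left, ip_sub_left, ip_smul_left, ip_add_right, ip_sub_right,
    ip_smul_right, h'.xx, h'.yy, h'.n₁n₁, h'.n₂n₂, h'.xy, h'.xn₁, h'.xn₂, h'.yn₁, h'.yn₂, h'.n₁n₂,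
    ip_comm y' x', ip_comm m₁ x', ip_comm m₁ y', ip_comm m₂ x', ip_comm m₂ y', ip_comm m₂ m₁,
    ip_comm x w, ip_comm y w, ip_comm n₁ w, ip_comm n₂ w]
  linear_combination (ε * ip v n₁ * ip w n₁ - ε * ip v n₂ * ip w n₂) * hε2

/-- An isometry is injective because products with an orthonormal frame separate vectors; in finite
dimension injectivity suffices. -/
theorem IsOrthonormalFrame.exists_linearEquiv {ε : ℝ} (hε : ε = 1 ∨ ε = -1)
    {x y n₁ n₂ x' y' m₁ m₂ : E42} (h : IsOrthonormalFrame ε x y n₁ n₂)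
    (h' : IsOrthonormalFrame ε x' y' m₁ m₂) :
    ∃ A : E42 ≃ₗ[ℝ] E42, (∀ v, A v = frameMap ε x' y' m₁ m₂ x y n₁ n₂ v) ∧
      ∀ v w, ip (A v) (A w) = ip v w := by
  have hinj : Function.Injective (frameMap ε x' y' m₁ m₂ x y n₁ n₂) := by
    intro v w hvw
    have : ∀ u, ip v u = ip w u := fun u => by
      rw [← h.frameMap_isometry hε h' v, ← h.frameMap_isometry hε h' w, hvw]
    exact h.ext_ip hε (this _) (this _) (this _) (this _)
  exact ⟨LinearEquiv.ofInjectiveEndo _ hinj, fun v => rfl, h.frameMap_isometry hε h'⟩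

/-! ### Directional derivatives -/

section Calculus

variable {F : Type*} [NormedAddCommGroup F] [NormedSpace ℝ F] {D : Set (ℝ × ℝ)} {p : ℝ × ℝ}

theorem fderiv_apply_eq (h : ℝ × ℝ → F) (p e : ℝ × ℝ) :
    fderiv ℝ h p e = e.1 • du h p + e.2 • dv h p := by
  simp only [du, dv, ← map_smul, ← map_add]
  congr 1
  ext <;> simp

theorem fderiv_eq_zero_of_du_dv {h : ℝ × ℝ → F} (hu : du h p = 0) (hv : dv h p = 0) :
    fderiv ℝ h p = 0 := by
  refine ContinuousLinearMap.ext fun e => ?_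
  simp [fderiv_apply_eq, hu, hv]

theorem eqOn_const_of_du_dv (hD : IsOpen D) (hc : IsConnected D) {h : ℝ × ℝ → F}
    (hd : DifferentiableOn ℝ h D) (hu : ∀ p ∈ D, du h p = 0) (hv : ∀ p ∈ D, dv h p = 0)
    {p q : ℝ × ℝ} (hp : p ∈ D) (hq : q ∈ D) : h p = h q :=
  hD.is_const_of_fderiv_eq_zero hc.isPreconnected hd
    (fun r hr => fderiv_eq_zero_of_du_dv (hu r hr) (hv r hr)) hp hq

theorem du_congr (hD : IsOpen D) {g h : ℝ × ℝ → F} (hgh : EqOn g h D) (hp : p ∈ D) :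
    du g p = du h p := by
  rw [du, du, (hgh.eventuallyEq_of_mem (hD.mem_nhds hp)).fderiv_eq]

theorem dv_congr (hD : IsOpen D) {g h : ℝ × ℝ → F} (hgh : EqOn g h D) (hp : p ∈ D) :
    dv g p = dv h p := by
  rw [dv, dv, (hgh.eventuallyEq_of_mem (hD.mem_nhds hp)).fderiv_eq]

theorem contDiffOn_du (hD : IsOpen D) {h : ℝ × ℝ → F} (hh : ContDiffOn ℝ ∞ h D) :
    ContDiffOn ℝ ∞ (du h) D :=
  (hh.fderiv_of_isOpen hD (by simp)).clm_apply contDiffOn_const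

theorem contDiffOn_dv (hD : IsOpen D) {h : ℝ × ℝ → F} (hh : ContDiffOn ℝ ∞ h D) :
    ContDiffOn ℝ ∞ (dv h) D :=
  (hh.fderiv_of_isOpen hD (by simp)).clm_apply contDiffOn_const

theorem differentiableAt_of_contDiffOn (hD : IsOpen D) {h : ℝ × ℝ → F} (hh : ContDiffOn ℝ ∞ h D)
    (hp : p ∈ D) : DifferentiableAt ℝ h p :=
  (hh.contDiffAt (hD.mem_nhds hp)).differentiableAt (by simp)

/-- Mixed partial derivatives commute. -/
theorem du_dv_comm (hD : IsOpen D) {h : ℝ × ℝ → F} (hh : ContDiffOn ℝ ∞ h D) (hp : p ∈ D) :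
    du (dv h) p = dv (du h) p := by
  have hd : DifferentiableAt ℝ (fderiv ℝ h) p :=
    differentiableAt_of_contDiffOn hD (hh.fderiv_of_isOpen hD (by simp)) hp
  have hs : IsSymmSndFDerivAt ℝ h p :=
    ((hh.contDiffAt (hD.mem_nhds hp))).isSymmSndFDerivAt (by
      simpa using (WithTop.coe_le_coe.2 le_top : ((2 : ℕ∞) : WithTop ℕ∞) ≤ ∞))
  have h1 : ∀ e e' : ℝ × ℝ,
      fderiv ℝ (fun q => fderiv ℝ h q e) p e' = fderiv ℝ (fderiv ℝ h) p e' e := by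
    intro e e'
    rw [fderiv_clm_apply hd (differentiableAt_const e)]
    simp
  change fderiv ℝ (fun q => fderiv ℝ h q (0, 1)) p (1, 0) =
    fderiv ℝ (fun q => fderiv ℝ h q (1, 0)) p (0, 1)
  rw [h1, h1, hs.eq]

theorem fderiv_smul_apply {c : ℝ × ℝ → ℝ} {h : ℝ × ℝ → F} (hc : DifferentiableAt ℝ c p)
    (hh : DifferentiableAt ℝ h p) (e : ℝ × ℝ) :
    fderiv ℝ (fun q => c q • h q) p e = c p • fderiv ℝ h p e + fderiv ℝ c p e • h p := by
  rw [fderiv_fun_smul hc hh]; simp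

theorem fderiv_smul_add_smul_apply {c d : ℝ × ℝ → ℝ} {g h : ℝ × ℝ → F}
    (hc : DifferentiableAt ℝ c p) (hd : DifferentiableAt ℝ d p)
    (hg : DifferentiableAt ℝ g p) (hh : DifferentiableAt ℝ h p) (e : ℝ × ℝ) :
    fderiv ℝ (fun q => c q • g q + d q • h q) p e =
      (c p • fderiv ℝ g p e + fderiv ℝ c p e • g p)
        + (d p • fderiv ℝ h p e + fderiv ℝ d p e • h p) := by
  rw [fderiv_fun_add (hc.fun_smul hg) (hd.fun_smul hh), _root_.add_apply, fderiv_smul_apply hc hg,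
    fderiv_smul_apply hd hh]

theorem fderiv_mul_apply {c d : ℝ × ℝ → ℝ} (hc : DifferentiableAt ℝ c p)
    (hd : DifferentiableAt ℝ d p) (e : ℝ × ℝ) :
    fderiv ℝ (fun q => c q * d q) p e = c p * fderiv ℝ d p e + fderiv ℝ c p e * d p :=
  fderiv_smul_apply hc hd e

theorem fderiv_coord (h : ℝ × ℝ → E42) (hh : DifferentiableAt ℝ h p) (i : Fin 4) (e : ℝ × ℝ) :
    fderiv ℝ (fun q => h q i) p e = fderiv ℝ h p e i := by
  rw [fderiv_apply hh]
  rfl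

theorem fderiv_ip {g h : ℝ × ℝ → E42} (hg : DifferentiableAt ℝ g p)
    (hh : DifferentiableAt ℝ h p) (e : ℝ × ℝ) :
    fderiv ℝ (fun q => ip (g q) (h q)) p e =
      ip (fderiv ℝ g p e) (h p) + ip (g p) (fderiv ℝ h p e) := by
  have hg' := fun i : Fin 4 => (differentiableAt_pi.1 hg i)
  have hh' := fun i : Fin 4 => (differentiableAt_pi.1 hh i)
  simp only [ip]
  rw [fderiv_fun_sub (by fun_prop) (by fun_prop), fderiv_fun_sub (by fun_prop) (by fun_prop),
    fderiv_fun_add (by fun_prop) (by fun_prop)]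
  simp only [_root_.sub_apply, _root_.add_apply, fderiv_mul_apply (hg' _) (hh' _),
    fderiv_coord _ hg, fderiv_coord _ hh]
  ring

theorem contDiffOn_ip {g h : ℝ × ℝ → E42} (hg : ContDiffOn ℝ ∞ g D) (hh : ContDiffOn ℝ ∞ h D) :
    ContDiffOn ℝ ∞ (fun q => ip (g q) (h q)) D := by
  have hg' := contDiffOn_pi.1 hg
  have hh' := contDiffOn_pi.1 hh
  simp only [ip]
  exact ((((hg' 0).mul (hh' 0)).add ((hg' 1).mul (hh' 1))).sub ((hg' 2).mul (hh' 2))).sub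
    ((hg' 3).mul (hh' 3))

end Calculus

/-! ### Frame equations -/

/-- The Gauss and Weingarten formulas of a frame along a surface, at one parameter value. -/
structure FrameEquations (ε : ℝ) (f a b N M B₁ B₂ : ℝ × ℝ → ℝ)
    (z x y n₁ n₂ : ℝ × ℝ → E42) (p : ℝ × ℝ) : Prop where
  zu : du z p = f p • x p
  zv : dv z p = f p • y p
  xu : du x p = a p • y p + N p • n₁ p
  xv : dv x p = b p • y p + M p • n₂ p
  yu : du y p = a p • x p + M p • n₂ p
  yv : dv y p = b p • x p + N p • n₁ p
  n₁u : du n₁ p = (-ε * N p) • x p + B₁ p • n₂ p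
  n₁v : dv n₁ p = (ε * N p) • y p + B₂ p • n₂ p
  n₂u : du n₂ p = (-ε * M p) • y p + B₁ p • n₁ p
  n₂v : dv n₂ p = (ε * M p) • x p + B₂ p • n₁ p

/-- The coefficient matrices of the frame equations are skew for the form diag(1, -1, ε, -ε), so in
the derivative of the pairing the terms cancel in pairs. Pairing a frame with itself shows that
orthonormality propagates; pairing two frames shows that the motion between them is constant. -/
theorem framePairing_const {D : Set (ℝ × ℝ)} (hD : IsOpen D) (hc : IsConnected D) {ε : ℝ}
    {f a b N M B₁ B₂ : ℝ × ℝ → ℝ} {z x y n₁ n₂ z' x' y' m₁ m₂ : ℝ × ℝ → E42}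
    (hε : ε = 1 ∨ ε = -1)
    (hx : DifferentiableOn ℝ x D) (hy : DifferentiableOn ℝ y D)
    (hn₁ : DifferentiableOn ℝ n₁ D) (hn₂ : DifferentiableOn ℝ n₂ D)
    (hx' : DifferentiableOn ℝ x' D) (hy' : DifferentiableOn ℝ y' D)
    (hm₁ : DifferentiableOn ℝ m₁ D) (hm₂ : DifferentiableOn ℝ m₂ D)
    (h : ∀ p ∈ D, FrameEquations ε f a b N M B₁ B₂ z x y n₁ n₂ p)
    (h' : ∀ p ∈ D, FrameEquations ε f a b N M B₁ B₂ z' x' y' m₁ m₂ p)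
    {p q : ℝ × ℝ} (hp : p ∈ D) (hq : q ∈ D) :
    framePairing ε (x' p) (y' p) (m₁ p) (m₂ p) (x p) (y p) (n₁ p) (n₂ p) =
      framePairing ε (x' q) (y' q) (m₁ q) (m₂ q) (x q) (y q) (n₁ q) (n₂ q) := by
  have hε2 : ε * ε = 1 := by rcases hε with rfl | rfl <;> norm_num
  ext i j
  have co : ∀ {w : ℝ × ℝ → E42}, DifferentiableOn ℝ w D → ∀ k : Fin 4,
      DifferentiableOn ℝ (fun q => w q k) D := fun hw k => differentiableOn_pi.1 hw k
  have der : ∀ r ∈ D, ∀ e, fderiv ℝ (fun r => framePairing ε (x' r) (y' r) (m₁ r) (m₂ r) (x r)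
      (y r) (n₁ r) (n₂ r) i j) r e =
      (x' r i * fderiv ℝ x r e j + fderiv ℝ x' r e i * x r j)
      - (y' r i * fderiv ℝ y r e j + fderiv ℝ y' r e i * y r j)
      + ε * (m₁ r i * fderiv ℝ n₁ r e j + fderiv ℝ m₁ r e i * n₁ r j)
      - ε * (m₂ r i * fderiv ℝ n₂ r e j + fderiv ℝ m₂ r e i * n₂ r j) := by
    intro r hr e
    have at' : ∀ {G : Type} [NormedAddCommGroup G] [NormedSpace ℝ G] {w : ℝ × ℝ → G},
      DifferentiableOn ℝ w D → DifferentiableAt ℝ w r := fun hw =>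
        hw.differentiableAt (hD.mem_nhds hr)
    have c1 := at' (co hx j)
    have c2 := at' (co hy j)
    have c3 := at' (co hn₁ j)
    have c4 := at' (co hn₂ j)
    have d1 := at' (co hx' i)
    have d2 := at' (co hy' i)
    have d3 := at' (co hm₁ i)
    have d4 := at' (co hm₂ i)
    simp only [framePairing]
    rw [fderiv_fun_sub (by fun_prop) (by fun_prop), fderiv_fun_add (by fun_prop) (by fun_prop),
      fderiv_fun_sub (by fun_prop) (by fun_prop), fderiv_const_mul (by fun_prop),
      fderiv_const_mul (by fun_prop)]
    simp only [_root_.sub_apply, _root_.add_apply, _root_.smul_apply, smul_eq_mul,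
      fderiv_mul_apply d1 c1, fderiv_mul_apply d2 c2, fderiv_mul_apply d3 c3, fderiv_mul_apply d4 c4,
      fderiv_coord _ (at' hx), fderiv_coord _ (at' hy), fderiv_coord _ (at' hn₁),
      fderiv_coord _ (at' hn₂), fderiv_coord _ (at' hx'), fderiv_coord _ (at' hy'),
      fderiv_coord _ (at' hm₁), fderiv_coord _ (at' hm₂)]
  refine eqOn_const_of_du_dv hD hc (h := fun r => framePairing ε (x' r) (y' r) (m₁ r) (m₂ r) (x r)
    (y r) (n₁ r) (n₂ r) i j) ?_ ?_ ?_ hp hq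
  · have := co hx j
    have := co hy j
    have := co hn₁ j
    have := co hn₂ j
    have := co hx' i
    have := co hy' i
    have := co hm₁ i
    have := co hm₂ i
    simp only [framePairing]
    fun_prop
  · intro r hr
    rw [du, der r hr]
    simp only [← du.eq_1, (h r hr).xu, (h r hr).yu, (h r hr).n₁u, (h r hr).n₂u, (h' r hr).xu,
      (h' r hr).yu, (h' r hr).n₁u, (h' r hr).n₂u, Pi.add_apply, Pi.smul_apply, smul_eq_mul]
    linear_combination (- x' r i * N r * n₁ r j - N r * m₁ r i * x r j + y' r i * M r * n₂ r j
      + m₂ r i * M r * y r j) * hε2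
  · intro r hr
    rw [dv, der r hr]
    simp only [← dv.eq_1, (h r hr).xv, (h r hr).yv, (h r hr).n₁v, (h r hr).n₂v, (h' r hr).xv,
      (h' r hr).yv, (h' r hr).n₁v, (h' r hr).n₂v, Pi.add_apply, Pi.smul_apply, smul_eq_mul]
    linear_combination (y' r i * N r * n₁ r j + N r * m₁ r i * y r j - x' r i * M r * n₂ r j
      - m₂ r i * M r * x r j) * hε2

/-- Two surfaces with the same frame equations differ by a rigid motion. -/
theorem eq_frameMap_of_frameEquations {D : Set (ℝ × ℝ)} (hD : IsOpen D) (hc : IsConnected D)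
    {ε : ℝ} {f a b N M B₁ B₂ : ℝ × ℝ → ℝ} {z x y n₁ n₂ z' x' y' m₁ m₂ : ℝ × ℝ → E42}
    (hε : ε = 1 ∨ ε = -1)
    (hz : DifferentiableOn ℝ z D) (hz' : DifferentiableOn ℝ z' D)
    (hx : DifferentiableOn ℝ x D) (hy : DifferentiableOn ℝ y D)
    (hn₁ : DifferentiableOn ℝ n₁ D) (hn₂ : DifferentiableOn ℝ n₂ D)
    (hx' : DifferentiableOn ℝ x' D) (hy' : DifferentiableOn ℝ y' D)
    (hm₁ : DifferentiableOn ℝ m₁ D) (hm₂ : DifferentiableOn ℝ m₂ D)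
    (h : ∀ p ∈ D, FrameEquations ε f a b N M B₁ B₂ z x y n₁ n₂ p)
    (h' : ∀ p ∈ D, FrameEquations ε f a b N M B₁ B₂ z' x' y' m₁ m₂ p)
    (ho : ∀ p ∈ D, IsOrthonormalFrame ε (x p) (y p) (n₁ p) (n₂ p))
    {w : ℝ × ℝ} (hw : w ∈ D) {p : ℝ × ℝ} (hp : p ∈ D) :
    z' p = frameMap ε (x' w) (y' w) (m₁ w) (m₂ w) (x w) (y w) (n₁ w) (n₂ w) (z p - z w) + z' w := by
  set A := frameMap ε (x' w) (y' w) (m₁ w) (m₂ w) (x w) (y w) (n₁ w) (n₂ w) with hA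
  let A' : E42 →L[ℝ] E42 := LinearMap.toContinuousLinearMap A
  have hA' : ∀ v, A' v = A v := fun v => rfl
  -- The map defined at w carries the frame to the primed frame at every q. Hence z' - A z has
  -- vanishing derivatives, since z_u, z_v and their primed analogues have the same scale factor f.
  have hAp : ∀ q ∈ D, A = frameMap ε (x' q) (y' q) (m₁ q) (m₂ q) (x q) (y q) (n₁ q) (n₂ q) := by
    intro q hq
    rw [hA, frameMap, frameMap,
      framePairing_const hD hc hε hx hy hn₁ hn₂ hx' hy' hm₁ hm₂ h h' hw hq]
  have hAx : ∀ q ∈ D, A (x q) = x' q := by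
    intro q hq
    have o := ho q hq
    rw [hAp q hq, frameMap_apply, o.xx, o.xy, o.xn₁, o.xn₂]
    simp
  have hAy : ∀ q ∈ D, A (y q) = y' q := by
    intro q hq
    have o := ho q hq
    rw [hAp q hq, frameMap_apply, o.yy, ip_comm, o.xy, o.yn₁, o.yn₂]
    simp
  have hder : ∀ q ∈ D, ∀ e, fderiv ℝ (fun q => z' q - A' (z q)) q e
      = fderiv ℝ z' q e - A (fderiv ℝ z q e) := by
    intro q hq e
    have d1 := hz.differentiableAt (hD.mem_nhds hq)
    have d2 := hz'.differentiableAt (hD.mem_nhds hq)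
    rw [fderiv_fun_sub d2 (by fun_prop), _root_.sub_apply]
    congr 1
    exact congrArg (fun L => L e) (A'.hasFDerivAt.comp q d1.hasFDerivAt).fderiv
  have := eqOn_const_of_du_dv hD hc (h := fun q => z' q - A' (z q))
    (hz'.sub (A'.differentiable.comp_differentiableOn hz))
    (fun q hq => by
      rw [du, hder q hq, ← du.eq_1, ← du.eq_1, (h q hq).zu, (h' q hq).zu, map_smul, hAx q hq,
        sub_self])
    (fun q hq => by
      rw [dv, hder q hq, ← dv.eq_1, ← dv.eq_1, (h q hq).zv, (h' q hq).zv, map_smul, hAy q hq,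
        sub_self]) hp hw
  simp only [hA'] at this
  rw [map_sub]
  linear_combination (exp := 1) this

/-! ### Geometry of a surface in isothermal parameters along an orthonormal frame -/

/-- At `p`, the coordinate directions of `z` are those of `x`, `y`, with scale factor `f > 0`, for
an orthonormal frame `(x, y, n₁, n₂)`. -/
structure IsAdapted (ε : ℝ) (f : ℝ × ℝ → ℝ) (z x y n₁ n₂ : ℝ × ℝ → E42) (p : ℝ × ℝ) : Prop where
  sign : ε = 1 ∨ ε = -1
  pos : 0 < f p
  frame : IsOrthonormalFrame ε (x p) (y p) (n₁ p) (n₂ p)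
  zu : du z p = f p • x p
  zv : dv z p = f p • y p

namespace IsAdapted

variable {ε : ℝ} {f : ℝ × ℝ → ℝ} {z x y n₁ n₂ : ℝ × ℝ → E42} {p : ℝ × ℝ}

theorem coeffE_eq (h : IsAdapted ε f z x y n₁ n₂ p) : coeffE z p = f p ^ 2 := by
  rw [coeffE, h.zu, ip_smul_left, ip_smul_right, h.frame.xx]; ring

theorem coeffF_eq (h : IsAdapted ε f z x y n₁ n₂ p) : coeffF z p = 0 := by
  rw [coeffF, h.zu, h.zv, ip_smul_left, ip_smul_right, h.frame.xy]; ring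

theorem coeffG_eq (h : IsAdapted ε f z x y n₁ n₂ p) : coeffG z p = -f p ^ 2 := by
  rw [coeffG, h.zv, ip_smul_left, ip_smul_right, h.frame.yy]; ring

theorem gram_eq (h : IsAdapted ε f z x y n₁ n₂ p) : gram z p = -f p ^ 4 := by
  rw [gram, h.coeffE_eq, h.coeffF_eq, h.coeffG_eq]; ring

theorem tangentCoords_eq (h : IsAdapted ε f z x y n₁ n₂ p) (w : E42) :
    tangentCoords z p w = (ip w (x p) / f p, -ip w (y p) / f p) := by
  have := h.pos.ne'
  rw [tangentCoords, h.gram_eq, h.coeffE_eq, h.coeffF_eq, h.coeffG_eq, h.zu, h.zv, ip_smul_right,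
    ip_smul_right]
  ext <;> field_simp <;> ring

theorem normalPart_eq_sub (h : IsAdapted ε f z x y n₁ n₂ p) (w : E42) :
    normalPart z p w = w - (ip w (x p) • x p - ip w (y p) • y p) := by
  have := h.pos.ne'
  rw [normalPart, h.tangentCoords_eq, h.zu, h.zv, smul_smul, smul_smul]
  simp only [div_mul_cancel₀ _ this, neg_smul]
  rw [← sub_eq_add_neg]

theorem normalPart_eq (h : IsAdapted ε f z x y n₁ n₂ p) (w : E42) :
    normalPart z p w = (ε * ip w (n₁ p)) • n₁ p - (ε * ip w (n₂ p)) • n₂ p := by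
  rw [h.normalPart_eq_sub]
  nth_rewrite 1 [h.frame.expansion h.sign w]
  abel

theorem tangentPlane_eq (h : IsAdapted ε f z x y n₁ n₂ p) :
    tangentPlane z p = Submodule.span ℝ {x p, y p} := by
  have := h.pos.ne'
  rw [tangentPlane, h.zu, h.zv]
  apply le_antisymm <;> rw [Submodule.span_le, insert_subset_iff, singleton_subset_iff]
  · exact ⟨Submodule.smul_mem _ _ (Submodule.subset_span (by simp)),
      Submodule.smul_mem _ _ (Submodule.subset_span (by simp))⟩
  · exact ⟨(Submodule.smul_mem_iff _ this).1 (Submodule.subset_span (mem_insert _ _)),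
      (Submodule.smul_mem_iff _ this).1 (Submodule.subset_span (mem_insert_of_mem _ rfl))⟩

theorem mem_normalPlane_iff (h : IsAdapted ε f z x y n₁ n₂ p) (w : E42) :
    w ∈ normalPlane z p ↔ ip w (x p) = 0 ∧ ip w (y p) = 0 := by
  have := h.pos.ne'
  change ip w (du z p) = 0 ∧ ip w (dv z p) = 0 ↔ _
  rw [h.zu, h.zv, ip_smul_right, ip_smul_right]
  simp [this]

theorem normalPlane_eq (h : IsAdapted ε f z x y n₁ n₂ p) :
    normalPlane z p = Submodule.span ℝ {n₁ p, n₂ p} := by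
  apply le_antisymm
  · intro w hw
    obtain ⟨h1, h2⟩ := (h.mem_normalPlane_iff w).1 hw
    rw [Submodule.mem_span_pair]
    refine ⟨ε * ip w (n₁ p), -(ε * ip w (n₂ p)), ?_⟩
    conv_rhs => rw [h.frame.expansion h.sign w, h1, h2]
    simp [sub_eq_add_neg]
  · rw [Submodule.span_le, insert_subset_iff, singleton_subset_iff]
    refine ⟨(h.mem_normalPlane_iff _).2 ⟨?_, ?_⟩, (h.mem_normalPlane_iff _).2 ⟨?_, ?_⟩⟩ <;>
      rw [ip_comm]
    exacts [h.frame.xn₁, h.frame.yn₁, h.frame.xn₂, h.frame.yn₂]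

theorem isCompl (h : IsAdapted ε f z x y n₁ n₂ p) :
    IsCompl (tangentPlane z p) (normalPlane z p) := by
  constructor
  · rw [Submodule.disjoint_def]
    intro w hw hw'
    obtain ⟨h1, h2⟩ := (h.mem_normalPlane_iff w).1 hw'
    rw [h.tangentPlane_eq, Submodule.mem_span_pair] at hw
    obtain ⟨α, β, rfl⟩ := hw
    simp only [ip_add_left, ip_smul_left, h.frame.xx, h.frame.yy, h.frame.xy, ip_comm (y p) (x p)]
      at h1 h2
    have hα : α = 0 := by linarith
    have hβ : β = 0 := by linarith
    simp [hα, hβ]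
  · rw [codisjoint_iff, eq_top_iff]
    intro w _
    rw [Submodule.mem_sup]
    refine ⟨ip w (x p) • x p - ip w (y p) • y p, ?_, normalPart z p w, ?_, ?_⟩
    · rw [h.tangentPlane_eq]
      exact Submodule.sub_mem _ (Submodule.smul_mem _ _ (Submodule.subset_span (by simp)))
        (Submodule.smul_mem _ _ (Submodule.subset_span (by simp)))
    · rw [h.normalPart_eq, h.normalPlane_eq]
      exact Submodule.sub_mem _ (Submodule.smul_mem _ _ (Submodule.subset_span (by simp)))
        (Submodule.smul_mem _ _ (Submodule.subset_span (by simp)))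
    · rw [h.normalPart_eq_sub]; abel

theorem isLorentzBasis_tangentPlane (h : IsAdapted ε f z x y n₁ n₂ p) :
    IsLorentzBasis (tangentPlane z p) (x p) (y p) :=
  ⟨h.tangentPlane_eq.symm, h.frame.xx, h.frame.yy, h.frame.xy⟩

theorem isLorentzBasis_normalPlane (h : IsAdapted 1 f z x y n₁ n₂ p) :
    IsLorentzBasis (normalPlane z p) (n₁ p) (n₂ p) :=
  ⟨h.normalPlane_eq.symm, h.frame.n₁n₁, h.frame.n₂n₂, h.frame.n₁n₂⟩

/-- For ε = -1 it is n₂ that has square 1, so the two normal vectors trade places. -/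
theorem isLorentzBasis_normalPlane' (h : IsAdapted (-1) f z x y n₁ n₂ p) :
    IsLorentzBasis (normalPlane z p) (n₂ p) (n₁ p) :=
  ⟨by rw [h.normalPlane_eq, pair_comm], by rw [h.frame.n₂n₂, neg_neg], h.frame.n₁n₁,
    by rw [ip_comm, h.frame.n₁n₂]⟩

theorem isLorentzAt (h : IsAdapted ε f z x y n₁ n₂ p) : IsLorentzAt z p := by
  refine ⟨h.isCompl, ⟨_, _, h.isLorentzBasis_tangentPlane⟩, ?_⟩
  rcases h.sign with rfl | rfl
  · exact ⟨_, _, h.isLorentzBasis_normalPlane⟩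
  · exact ⟨_, _, h.isLorentzBasis_normalPlane'⟩

theorem normalPart_add (h : IsAdapted ε f z x y n₁ n₂ p) (v w : E42) :
    normalPart z p (v + w) = normalPart z p v + normalPart z p w := by
  simp only [h.normalPart_eq_sub, ip_add_left, add_smul]; abel

theorem normalPart_smul (h : IsAdapted ε f z x y n₁ n₂ p) (c : ℝ) (v : E42) :
    normalPart z p (c • v) = c • normalPart z p v := by
  simp only [h.normalPart_eq_sub, ip_smul_left, smul_sub, smul_smul]

theorem normalPart_x (h : IsAdapted ε f z x y n₁ n₂ p) : normalPart z p (x p) = 0 := by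
  simp [h.normalPart_eq, h.frame.xn₁, h.frame.xn₂]

theorem normalPart_y (h : IsAdapted ε f z x y n₁ n₂ p) : normalPart z p (y p) = 0 := by
  simp [h.normalPart_eq, h.frame.yn₁, h.frame.yn₂]

theorem normalPart_n₁ (h : IsAdapted ε f z x y n₁ n₂ p) : normalPart z p (n₁ p) = n₁ p := by
  simp [h.normalPart_eq_sub, ip_comm (n₁ p), h.frame.xn₁, h.frame.yn₁]

theorem normalPart_n₂ (h : IsAdapted ε f z x y n₁ n₂ p) : normalPart z p (n₂ p) = n₂ p := by
  simp [h.normalPart_eq_sub, ip_comm (n₂ p), h.frame.xn₂, h.frame.yn₂]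

/-- The second fundamental form in terms of the derivatives of the tangent frame. -/
theorem secondForm_eq {D : Set (ℝ × ℝ)} (hD : IsOpen D)
    (h : ∀ q ∈ D, IsAdapted ε f z x y n₁ n₂ q) (hp : p ∈ D) (hf : DifferentiableAt ℝ f p)
    (hx : DifferentiableAt ℝ x p) (hy : DifferentiableAt ℝ y p) (v w : E42) :
    secondForm z p v w = (1 / f p) •
      (ip v (x p) • (ip w (x p) • normalPart z p (du x p) - ip w (y p) • normalPart z p (du y p))
      - ip v (y p) • (ip w (x p) • normalPart z p (dv x p)
        - ip w (y p) • normalPart z p (dv y p))) := by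
  have hp' := h p hp
  have hne := hp'.pos.ne'
  -- The coordinates of w are frozen at p, and only f, x, y vary with q. The derivatives of f
  -- multiply x and y, so they disappear under the normal projection.
  have h1 : EqOn (fun q => fderiv ℝ z q (tangentCoords z p w))
      (fun q => (ip w (x p) / f p * f q) • x q + (-ip w (y p) / f p * f q) • y q) D := by
    intro q hq
    simp only [fderiv_apply_eq, hp'.tangentCoords_eq, (h q hq).zu, (h q hq).zv, smul_smul]
  rw [secondForm, fderiv_apply_eq, du_congr hD h1 hp, dv_congr hD h1 hp, hp'.tangentCoords_eq v,
    du, dv, fderiv_smul_add_smul_apply (by fun_prop) (by fun_prop) hx hy,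
    fderiv_smul_add_smul_apply (by fun_prop) (by fun_prop) hx hy]
  simp only [← du.eq_1, ← dv.eq_1, hp'.normalPart_add, hp'.normalPart_smul, hp'.normalPart_x,
    hp'.normalPart_y, smul_zero, add_zero]
  match_scalars <;> field_simp

end IsAdapted

/-! ### Second fundamental form and curvatures from the frame equations -/

/-- A surface with a smooth orthonormal frame on `D` along its isothermal coordinate directions
whose frame equations have the given coefficients. -/
structure IsFramedSurface (D : Set (ℝ × ℝ)) (ε : ℝ) (f a b N M B₁ B₂ : ℝ × ℝ → ℝ)
    (z x y n₁ n₂ : ℝ × ℝ → E42) : Prop where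
  isOpen : IsOpen D
  smooth_f : ContDiffOn ℝ ∞ f D
  smooth_z : ContDiffOn ℝ ∞ z D
  smooth_x : ContDiffOn ℝ ∞ x D
  smooth_y : ContDiffOn ℝ ∞ y D
  smooth_n₁ : ContDiffOn ℝ ∞ n₁ D
  smooth_n₂ : ContDiffOn ℝ ∞ n₂ D
  adapted : ∀ p ∈ D, IsAdapted ε f z x y n₁ n₂ p
  equations : ∀ p ∈ D, FrameEquations ε f a b N M B₁ B₂ z x y n₁ n₂ p

namespace IsFramedSurface

variable {D : Set (ℝ × ℝ)} {ε : ℝ} {f a b N M B₁ B₂ : ℝ × ℝ → ℝ} {z x y n₁ n₂ : ℝ × ℝ → E42}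
  {p : ℝ × ℝ}

/-- N and M are normal components of derivatives along the coordinate fields f x and f y, whence the
division by f. The minus sign comes from ⟨y, y⟩ = -1. -/
theorem secondForm_eq (h : IsFramedSurface D ε f a b N M B₁ B₂ z x y n₁ n₂) (hp : p ∈ D)
    (v w : E42) :
    secondForm z p v w =
      ((ip v (x p) * ip w (x p) + ip v (y p) * ip w (y p)) * (N p / f p)) • n₁ p
      - ((ip v (x p) * ip w (y p) + ip v (y p) * ip w (x p)) * (M p / f p)) • n₂ p := by
  have h1 := h.adapted p hp
  have h2 := h.equations p hp
  rw [IsAdapted.secondForm_eq h.isOpen h.adapted hp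
    (differentiableAt_of_contDiffOn h.isOpen h.smooth_f hp)
    (differentiableAt_of_contDiffOn h.isOpen h.smooth_x hp)
    (differentiableAt_of_contDiffOn h.isOpen h.smooth_y hp), h2.xu, h2.xv, h2.yu, h2.yv]
  simp only [h1.normalPart_add, h1.normalPart_smul, h1.normalPart_x, h1.normalPart_y,
    h1.normalPart_n₁, h1.normalPart_n₂, smul_zero, zero_add]
  match_scalars <;> field_simp <;> ring

theorem secondForm_xx (h : IsFramedSurface D ε f a b N M B₁ B₂ z x y n₁ n₂) (hp : p ∈ D) :
    secondForm z p (x p) (x p) = (N p / f p) • n₁ p := by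
  have o := (h.adapted p hp).frame
  rw [h.secondForm_eq hp, o.xx, o.xy]
  simp

theorem secondForm_xy (h : IsFramedSurface D ε f a b N M B₁ B₂ z x y n₁ n₂) (hp : p ∈ D) :
    secondForm z p (x p) (y p) = (M p / f p) • n₂ p := by
  have o := (h.adapted p hp).frame
  rw [h.secondForm_eq hp, o.xx, o.xy, ip_comm (y p), o.xy, o.yy]
  simp

theorem secondForm_yy (h : IsFramedSurface D ε f a b N M B₁ B₂ z x y n₁ n₂) (hp : p ∈ D) :
    secondForm z p (y p) (y p) = (N p / f p) • n₁ p := by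
  have o := (h.adapted p hp).frame
  rw [h.secondForm_eq hp, ip_comm (y p), o.xy, o.yy]
  simp

theorem secondForm_uu (h : IsFramedSurface D ε f a b N M B₁ B₂ z x y n₁ n₂) (hp : p ∈ D) :
    secondForm z p (du z p) (du z p) = (f p * N p) • n₁ p := by
  have h1 := h.adapted p hp
  have := h1.pos.ne'
  rw [h.secondForm_eq hp, h1.zu]
  simp only [ip_smul_left, h1.frame.xx, h1.frame.xy]
  match_scalars <;> field_simp
  all_goals simp

theorem secondForm_uv (h : IsFramedSurface D ε f a b N M B₁ B₂ z x y n₁ n₂) (hp : p ∈ D) :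
    secondForm z p (du z p) (dv z p) = (f p * M p) • n₂ p := by
  have h1 := h.adapted p hp
  have := h1.pos.ne'
  rw [h.secondForm_eq hp, h1.zu, h1.zv]
  simp only [ip_smul_left, h1.frame.xx, h1.frame.xy, h1.frame.yy, ip_comm (y p) (x p)]
  match_scalars <;> field_simp
  all_goals simp

theorem secondForm_vv (h : IsFramedSurface D ε f a b N M B₁ B₂ z x y n₁ n₂) (hp : p ∈ D) :
    secondForm z p (dv z p) (dv z p) = (f p * N p) • n₁ p := by
  have h1 := h.adapted p hp
  have := h1.pos.ne'
  rw [h.secondForm_eq hp, h1.zv]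
  simp only [ip_smul_left, h1.frame.xy, h1.frame.yy, ip_comm (y p) (x p)]
  match_scalars <;> field_simp
  all_goals simp

theorem meanCurvature_eq_zero (h : IsFramedSurface D ε f a b N M B₁ B₂ z x y n₁ n₂) (hp : p ∈ D) :
    meanCurvature z p = 0 := by
  have h1 := h.adapted p hp
  rw [meanCurvature, h.secondForm_uu hp, h.secondForm_vv hp, h1.coeffE_eq, h1.coeffF_eq,
    h1.coeffG_eq]
  simp

theorem gaussCurvature_eq (h : IsFramedSurface D ε f a b N M B₁ B₂ z x y n₁ n₂) (hp : p ∈ D) :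
    gaussCurvature z p = -ε * ((N p / f p) ^ 2 + (M p / f p) ^ 2) := by
  have h1 := h.adapted p hp
  have := h1.pos.ne'
  rw [gaussCurvature, h.secondForm_uu hp, h.secondForm_vv hp, h.secondForm_uv hp, h1.gram_eq]
  simp only [ip_smul_left, ip_smul_right, h1.frame.n₁n₁, h1.frame.n₂n₂]
  field_simp
  ring

theorem finrank_firstNormalSpace (h : IsFramedSurface D ε f a b N M B₁ B₂ z x y n₁ n₂)
    (hp : p ∈ D) (hN : N p ≠ 0) (hM : M p ≠ 0) :
    Module.finrank ℝ (firstNormalSpace z p) = 2 := by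
  have h1 := h.adapted p hp
  have o := h1.frame
  have hne := h1.pos.ne'
  have hspan : firstNormalSpace z p = Submodule.span ℝ {n₁ p, n₂ p} := by
    apply le_antisymm
    · rw [firstNormalSpace, Submodule.span_le]
      rintro w ⟨v, -, v', -, rfl⟩
      rw [h.secondForm_eq hp]
      exact Submodule.sub_mem _ (Submodule.smul_mem _ _ (Submodule.subset_span (by simp)))
        (Submodule.smul_mem _ _ (Submodule.subset_span (by simp)))
    · have hx : x p ∈ tangentPlane z p := by
        rw [h1.tangentPlane_eq]; exact Submodule.subset_span (by simp)
      have hy : y p ∈ tangentPlane z p := by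
        rw [h1.tangentPlane_eq]; exact Submodule.subset_span (by simp)
      rw [Submodule.span_le, insert_subset_iff, singleton_subset_iff]
      constructor
      · have : n₁ p = (N p / f p)⁻¹ • secondForm z p (x p) (x p) := by
          rw [h.secondForm_xx hp, smul_smul, inv_mul_cancel₀ (div_ne_zero hN hne), one_smul]
        rw [this]
        exact Submodule.smul_mem _ _ (Submodule.subset_span ⟨_, hx, _, hx, rfl⟩)
      · have : n₂ p = (M p / f p)⁻¹ • secondForm z p (x p) (y p) := by
          rw [h.secondForm_xy hp, smul_smul, inv_mul_cancel₀ (div_ne_zero hM hne), one_smul]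
        rw [this]
        exact Submodule.smul_mem _ _ (Submodule.subset_span ⟨_, hx, _, hy, rfl⟩)
  have hεne : ε ≠ 0 := by rcases h1.sign with h | h <;> rw [h] <;> norm_num
  have hli : LinearIndependent ℝ ![n₁ p, n₂ p] := by
    rw [LinearIndependent.pair_iff]
    intro s t hst
    have e1 : ip (s • n₁ p + t • n₂ p) (n₁ p) = 0 := by rw [hst, ip_zero_left]
    have e2 : ip (s • n₁ p + t • n₂ p) (n₂ p) = 0 := by rw [hst, ip_zero_left]
    simp only [ip_add_left, ip_smul_left, o.n₁n₁, o.n₂n₂, o.n₁n₂, ip_comm (n₂ p) (n₁ p)] at e1 e2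
    constructor
    · simpa [hεne] using e1
    · simpa [hεne] using e2
  rw [hspan, ← Matrix.range_cons_cons_empty (n₁ p) (n₂ p) ![], finrank_span_eq_card hli]
  rfl

theorem normalDu_n₁ (h : IsFramedSurface D ε f a b N M B₁ B₂ z x y n₁ n₂) (hp : p ∈ D) :
    normalDu z n₁ p = B₁ p • n₂ p := by
  have h1 := h.adapted p hp
  rw [normalDu, (h.equations p hp).n₁u, h1.normalPart_add, h1.normalPart_smul, h1.normalPart_smul,
    h1.normalPart_x, h1.normalPart_n₂, smul_zero, zero_add]

theorem normalDv_n₁ (h : IsFramedSurface D ε f a b N M B₁ B₂ z x y n₁ n₂) (hp : p ∈ D) :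
    normalDv z n₁ p = B₂ p • n₂ p := by
  have h1 := h.adapted p hp
  rw [normalDv, (h.equations p hp).n₁v, h1.normalPart_add, h1.normalPart_smul, h1.normalPart_smul,
    h1.normalPart_y, h1.normalPart_n₂, smul_zero, zero_add]

theorem normalDu_n₂ (h : IsFramedSurface D ε f a b N M B₁ B₂ z x y n₁ n₂) (hp : p ∈ D) :
    normalDu z n₂ p = B₁ p • n₁ p := by
  have h1 := h.adapted p hp
  rw [normalDu, (h.equations p hp).n₂u, h1.normalPart_add, h1.normalPart_smul, h1.normalPart_smul,
    h1.normalPart_y, h1.normalPart_n₁, smul_zero, zero_add]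

theorem normalDv_n₂ (h : IsFramedSurface D ε f a b N M B₁ B₂ z x y n₁ n₂) (hp : p ∈ D) :
    normalDv z n₂ p = B₂ p • n₁ p := by
  have h1 := h.adapted p hp
  rw [normalDv, (h.equations p hp).n₂v, h1.normalPart_add, h1.normalPart_smul, h1.normalPart_smul,
    h1.normalPart_x, h1.normalPart_n₁, smul_zero, zero_add]

/-- The normal bundle has rank two, so the quadratic terms B₁ B₂ cancel and only the curl of (B₁,
B₂) survives. The version for n₂ serves ε = -1, where the normal basis is taken in the other order.
-/
theorem normalCurvatureTensor_n₁ (h : IsFramedSurface D ε f a b N M B₁ B₂ z x y n₁ n₂)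
    (hB₁ : DifferentiableAt ℝ B₁ p) (hB₂ : DifferentiableAt ℝ B₂ p) (hp : p ∈ D) :
    normalCurvatureTensor z p (x p) (y p) n₁ = ((du B₂ p - dv B₁ p) / f p ^ 2) • n₂ p := by
  have h1 := h.adapted p hp
  have hne := h1.pos.ne'
  have hn := differentiableAt_of_contDiffOn h.isOpen h.smooth_n₂ hp
  have e1 : normalDu z (normalDv z n₁) p = du B₂ p • n₂ p + (B₂ p * B₁ p) • n₁ p := by
    rw [normalDu, du_congr h.isOpen (fun q hq => h.normalDv_n₁ hq) hp, du,
      fderiv_smul_apply hB₂ hn, h1.normalPart_add, h1.normalPart_smul, h1.normalPart_smul,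
      h1.normalPart_n₂, ← du.eq_1, ← du.eq_1, ← normalDu, h.normalDu_n₂ hp, smul_smul, add_comm]
  have e2 : normalDv z (normalDu z n₁) p = dv B₁ p • n₂ p + (B₁ p * B₂ p) • n₁ p := by
    rw [normalDv, dv_congr h.isOpen (fun q hq => h.normalDu_n₁ hq) hp, dv,
      fderiv_smul_apply hB₁ hn, h1.normalPart_add, h1.normalPart_smul, h1.normalPart_smul,
      h1.normalPart_n₂, ← dv.eq_1, ← dv.eq_1, ← normalDv, h.normalDv_n₂ hp, smul_smul, add_comm]
  rw [normalCurvatureTensor, e1, e2, h1.tangentCoords_eq, h1.tangentCoords_eq, h1.frame.xx,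
    h1.frame.yy, h1.frame.xy]
  match_scalars <;> field_simp <;> ring

theorem normalCurvatureTensor_n₂ (h : IsFramedSurface D ε f a b N M B₁ B₂ z x y n₁ n₂)
    (hB₁ : DifferentiableAt ℝ B₁ p) (hB₂ : DifferentiableAt ℝ B₂ p) (hp : p ∈ D) :
    normalCurvatureTensor z p (x p) (y p) n₂ = ((du B₂ p - dv B₁ p) / f p ^ 2) • n₁ p := by
  have h1 := h.adapted p hp
  have hne := h1.pos.ne'
  have hn := differentiableAt_of_contDiffOn h.isOpen h.smooth_n₁ hp
  have e1 : normalDu z (normalDv z n₂) p = du B₂ p • n₁ p + (B₂ p * B₁ p) • n₂ p := by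
    rw [normalDu, du_congr h.isOpen (fun q hq => h.normalDv_n₂ hq) hp, du,
      fderiv_smul_apply hB₂ hn, h1.normalPart_add, h1.normalPart_smul, h1.normalPart_smul,
      h1.normalPart_n₁, ← du.eq_1, ← du.eq_1, ← normalDu, h.normalDu_n₁ hp, smul_smul, add_comm]
  have e2 : normalDv z (normalDu z n₂) p = dv B₁ p • n₁ p + (B₁ p * B₂ p) • n₂ p := by
    rw [normalDv, dv_congr h.isOpen (fun q hq => h.normalDu_n₂ hq) hp, dv,
      fderiv_smul_apply hB₁ hn, h1.normalPart_add, h1.normalPart_smul, h1.normalPart_smul,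
      h1.normalPart_n₁, ← dv.eq_1, ← dv.eq_1, ← normalDv, h.normalDv_n₁ hp, smul_smul, add_comm]
  rw [normalCurvatureTensor, e1, e2, h1.tangentCoords_eq, h1.tangentCoords_eq, h1.frame.xx,
    h1.frame.yy, h1.frame.xy]
  match_scalars <;> field_simp <;> ring

/-- With ν = N / f and μ = M / f one has K = -ε (ν² + μ²), and the Ricci equation gives ϰ = ±2 μ ν.
Hence K² - ϰ² = (ν² - μ²)². -/
theorem hasPositiveDiscriminant (h : IsFramedSurface D ε f a b N M B₁ B₂ z x y n₁ n₂)
    (hB₁ : DifferentiableAt ℝ B₁ p) (hB₂ : DifferentiableAt ℝ B₂ p) (hp : p ∈ D)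
    (hricci : dv B₁ p - du B₂ p = 2 * ε * N p * M p) (hne : N p ^ 2 - M p ^ 2 ≠ 0) :
    HasPositiveDiscriminant z p := by
  have h1 := h.adapted p hp
  have hf := h1.pos.ne'
  have o := h1.frame
  have hpos : 0 < ((N p / f p) ^ 2 - (M p / f p) ^ 2) ^ 2 := by
    have : (N p / f p) ^ 2 - (M p / f p) ^ 2 ≠ 0 := by
      rw [div_pow, div_pow, ← sub_div]
      exact div_ne_zero hne (pow_ne_zero 2 hf)
    positivity
  have hr : du B₂ p - dv B₁ p = -(2 * ε * N p * M p) := by linarith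
  rcases h1.sign with rfl | rfl
  · refine ⟨x p, y p, D, n₁, n₂, h1.isLorentzBasis_tangentPlane, h.isOpen, hp, h.smooth_n₁,
      h.smooth_n₂, fun q hq => (h.adapted q hq).isLorentzBasis_normalPlane, ?_⟩
    rw [h.gaussCurvature_eq hp, normalCurvature, h.normalCurvatureTensor_n₁ hB₁ hB₂ hp, hr,
      ip_smul_left, o.n₂n₂, o.xx, o.yy, o.xy]
    convert! hpos using 1
    field_simp
    ring
  · refine ⟨x p, y p, D, n₂, n₁, h1.isLorentzBasis_tangentPlane, h.isOpen, hp, h.smooth_n₂,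
      h.smooth_n₁, fun q hq => (h.adapted q hq).isLorentzBasis_normalPlane', ?_⟩
    rw [h.gaussCurvature_eq hp, normalCurvature, h.normalCurvatureTensor_n₂ hB₁ hB₂ hp, hr,
      ip_smul_left, o.n₁n₁, o.xx, o.yy, o.xy]
    convert! hpos using 1
    field_simp
    ring

theorem isMinimalLorentzOfGeneralType (h : IsFramedSurface D ε f a b N M B₁ B₂ z x y n₁ n₂)
    (hB₁ : ContDiffOn ℝ ∞ B₁ D) (hB₂ : ContDiffOn ℝ ∞ B₂ D)
    (hricci : ∀ p ∈ D, dv B₁ p - du B₂ p = 2 * ε * N p * M p)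
    (hN : ∀ p ∈ D, N p ≠ 0) (hM : ∀ p ∈ D, M p ≠ 0) (hne : ∀ p ∈ D, N p ^ 2 - M p ^ 2 ≠ 0) :
    IsMinimalLorentzOfGeneralType z D where
  smooth := h.smooth_z
  lorentz p hp := (h.adapted p hp).isLorentzAt
  minimal _ hp := h.meanCurvature_eq_zero hp
  two_dim p hp := h.finrank_firstNormalSpace hp (hN p hp) (hM p hp)
  general := ⟨D, subset_rfl, h.isOpen, subset_closure, fun p hp =>
    h.hasPositiveDiscriminant (differentiableAt_of_contDiffOn h.isOpen hB₁ hp)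
      (differentiableAt_of_contDiffOn h.isOpen hB₂ hp) hp (hricci p hp) (hne p hp)⟩

theorem isGeometricFrame {μ ν : ℝ × ℝ → ℝ}
    (h : IsFramedSurface D ε f a b N M B₁ B₂ z x y n₁ n₂)
    (hN : ∀ p ∈ D, N p = f p * ν p) (hM : ∀ p ∈ D, M p = f p * μ p)
    (hprod : ∀ p ∈ D, μ p * ν p ≠ 0) :
    IsGeometricFrame z D ε μ ν x y n₁ n₂ where
  smooth_x := h.smooth_x
  smooth_y := h.smooth_y
  smooth_n₁ := h.smooth_n₁
  smooth_n₂ := h.smooth_n₂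
  tangent_x p hp := by
    rw [(h.adapted p hp).tangentPlane_eq]; exact Submodule.subset_span (by simp)
  tangent_y p hp := by
    rw [(h.adapted p hp).tangentPlane_eq]; exact Submodule.subset_span (by simp)
  normal_n₁ p hp := by
    rw [(h.adapted p hp).normalPlane_eq]; exact Submodule.subset_span (by simp)
  normal_n₂ p hp := by
    rw [(h.adapted p hp).normalPlane_eq]; exact Submodule.subset_span (by simp)
  orthonormal p hp := (h.adapted p hp).frame
  sigma_xx p hp := by
    rw [h.secondForm_xx hp, hN p hp, mul_div_cancel_left₀ _ (h.adapted p hp).pos.ne']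
  sigma_xy p hp := by
    rw [h.secondForm_xy hp, hM p hp, mul_div_cancel_left₀ _ (h.adapted p hp).pos.ne']
  sigma_yy p hp := by
    rw [h.secondForm_yy hp, hN p hp, mul_div_cancel_left₀ _ (h.adapted p hp).pos.ne']
  mul_ne_zero := hprod

theorem isIsothermalAlong (h : IsFramedSurface D ε f a b N M B₁ B₂ z x y n₁ n₂) :
    IsIsothermalAlong z D x y :=
  ⟨f, fun p hp => ⟨(h.adapted p hp).pos, (h.adapted p hp).zu, (h.adapted p hp).zv⟩⟩

end IsFramedSurface

/-! ### Existence of surfaces with given frame equations -/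

/-- The continuous linear operator given by a square matrix. -/
noncomputable def matrixOp (n : ℕ) : (Fin n → Fin n → ℝ) →L[ℝ] (Fin n → ℝ) →L[ℝ] (Fin n → ℝ) :=
  LinearMap.toContinuousLinearMap
    ((LinearMap.toContinuousLinearMap (𝕜 := ℝ) (E := Fin n → ℝ) (F' := Fin n → ℝ)).toLinearMap ∘ₗ
      (Matrix.toLin' (R := ℝ) (m := Fin n) (n := Fin n)).toLinearMap)

theorem matrixOp_apply (n : ℕ) (A : Fin n → Fin n → ℝ) (x : Fin n → ℝ) (i : Fin n) :
    matrixOp n A x i = ∑ j, A i j * x j := rfl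

set_option maxSynthPendingDepth 3 in
/-- The linear system `φ_u = A φ`, `φ_v = B φ` is locally solvable if `A_v + A B = B_u + B A`. -/
theorem exists_linear_system {n : ℕ} {D : Set (ℝ × ℝ)} (hD : IsOpen D) {w : ℝ × ℝ} (hw : w ∈ D)
    {A B : ℝ × ℝ → Fin n → Fin n → ℝ} (hA : ContDiffOn ℝ ∞ A D) (hB : ContDiffOn ℝ ∞ B D)
    (hflat : ∀ p ∈ D, ∀ i j, dv (fun q => A q i j) p + ∑ k, A p i k * B p k j
      = du (fun q => B q i j) p + ∑ k, B p i k * A p k j) :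
    ∃ r > 0, Metric.ball w r ⊆ D ∧ ∀ c : Fin n → ℝ, ∃ φ : ℝ × ℝ → Fin n → ℝ,
      ContDiffOn ℝ ∞ φ (Metric.ball w r) ∧ φ w = c ∧ ∀ p ∈ Metric.ball w r, ∀ i,
        du φ p i = ∑ j, A p i j * φ p j ∧ dv φ p i = ∑ j, B p i j * φ p j := by
  let S := ContinuousLinearMap.smulRightL ℝ (ℝ × ℝ) ((Fin n → ℝ) →L[ℝ] (Fin n → ℝ))
  let L₁ := S (ContinuousLinearMap.fst ℝ ℝ ℝ) ∘L matrixOp n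
  let L₂ := S (ContinuousLinearMap.snd ℝ ℝ ℝ) ∘L matrixOp n
  let Ω : ℝ × ℝ → ℝ × ℝ →L[ℝ] (Fin n → ℝ) →L[ℝ] (Fin n → ℝ) := fun p => L₁ (A p) + L₂ (B p)
  have hΩa : ∀ p e, Ω p e = e.1 • matrixOp n (A p) + e.2 • matrixOp n (B p) := fun p e => rfl
  have hΩ : ContDiffOn ℝ ∞ Ω D :=
    (L₁.contDiff.comp_contDiffOn hA).add (L₂.contDiff.comp_contDiffOn hB)
  have hdΩ : ∀ p ∈ D, ∀ h k, fderiv ℝ Ω p h k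
      = k.1 • matrixOp n (fderiv ℝ A p h) + k.2 • matrixOp n (fderiv ℝ B p h) := by
    intro p hp h k
    have dA := (differentiableAt_of_contDiffOn hD hA hp).hasFDerivAt
    have dB := (differentiableAt_of_contDiffOn hD hB hp).hasFDerivAt
    have : HasFDerivAt Ω (L₁ ∘L fderiv ℝ A p + L₂ ∘L fderiv ℝ B p) p :=
      (L₁.hasFDerivAt.comp p dA).add (L₂.hasFDerivAt.comp p dB)
    rw [this.fderiv]
    rfl
  have hentry : ∀ {C : ℝ × ℝ → Fin n → Fin n → ℝ}, ContDiffOn ℝ ∞ C D → ∀ p ∈ D, ∀ e i j,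
      fderiv ℝ (fun q => C q i j) p e = fderiv ℝ C p e i j := by
    intro C hC p hp e i j
    have dC := differentiableAt_of_contDiffOn hD hC hp
    have dCi : DifferentiableAt ℝ (fun q => C q i) p := differentiableAt_pi.1 dC i
    rw [fderiv_apply dCi, fderiv_apply dC]
    rfl
  have hcomp : ∀ p ∈ D, ∀ x, matrixOp n (dv A p) x + matrixOp n (A p) (matrixOp n (B p) x)
      = matrixOp n (du B p) x + matrixOp n (B p) (matrixOp n (A p) x) := by
    intro p hp x
    have hswap : ∀ (P Q : Fin n → Fin n → ℝ) (i : Fin n),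
        ∑ j, P i j * ∑ k, Q j k * x k = ∑ k, (∑ j, P i j * Q j k) * x k := by
      intro P Q i
      simp only [Finset.mul_sum, Finset.sum_mul]
      rw [Finset.sum_comm]
      simp only [mul_assoc]
    ext i
    simp only [Pi.add_apply, matrixOp_apply, hswap, ← Finset.sum_add_distrib, ← add_mul]
    refine Finset.sum_congr rfl fun j _ => ?_
    have hij := hflat p hp i j
    rw [dv, du, hentry hA p hp, hentry hB p hp] at hij
    rw [dv, du, hij]
  obtain ⟨r, hr, hrD, hsol⟩ := exists_parallel Ω hD hw hΩ (by
    intro p hp h k x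
    rw [hdΩ p hp, hdΩ p hp, hΩa, hΩa, fderiv_apply_eq A p h, fderiv_apply_eq A p k,
      fderiv_apply_eq B p h, fderiv_apply_eq B p k]
    simp only [map_add, map_smul, _root_.add_apply, _root_.smul_apply, smul_add]
    -- The flatness defect is alternating in (h, k), so in the plane it is a multiple of its value
    -- on the two coordinate directions.
    linear_combination (norm := module) (k.1 * h.2 - k.2 * h.1) • hcomp p hp x)
  refine ⟨r, hr, hrD, fun c => ?_⟩
  obtain ⟨φ, hφ, hφw, hd⟩ := hsol c
  refine ⟨φ, hφ, hφw, fun p hp i => ⟨?_, ?_⟩⟩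
  · rw [du, (hd p hp).fderiv, ContinuousLinearMap.flip_apply, hΩa]
    simp [matrixOp_apply]
  · rw [dv, (hd p hp).fderiv, ContinuousLinearMap.flip_apply, hΩa]
    simp [matrixOp_apply]

/-- The equations of Gauss, Codazzi and Ricci for the coefficients of the frame equations, together
with the compatibility of `z_u = f x`, `z_v = f y`. -/
structure IntegrabilityEquations (ε : ℝ) (f a b N M B₁ B₂ : ℝ × ℝ → ℝ) (p : ℝ × ℝ) : Prop where
  fu : du f p = f p * b p
  fv : dv f p = f p * a p
  gauss : dv a p = du b p - ε * (N p ^ 2 + M p ^ 2)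
  Nu : du N p = M p * B₂ p - b p * N p
  Nv : dv N p = M p * B₁ p - a p * N p
  Mu : du M p = N p * B₂ p - b p * M p
  Mv : dv M p = N p * B₁ p - a p * M p
  ricci : dv B₁ p = du B₂ p + 2 * ε * N p * M p

/-- Each of the four coordinates of (z, x, y, n₁, n₂) satisfies the same 5 × 5 linear system, and
the entries of its flatness condition are the integrability equations. Including z in the system
avoids a separate integration of z_u = f x, z_v = f y. -/
theorem exists_framedSurface {D : Set (ℝ × ℝ)} (hD : IsOpen D) {w : ℝ × ℝ} (hw : w ∈ D) {ε : ℝ}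
    (hε : ε = 1 ∨ ε = -1) {f a b N M B₁ B₂ : ℝ × ℝ → ℝ} (hf : ContDiffOn ℝ ∞ f D)
    (ha : ContDiffOn ℝ ∞ a D) (hb : ContDiffOn ℝ ∞ b D) (hN : ContDiffOn ℝ ∞ N D)
    (hM : ContDiffOn ℝ ∞ M D) (hB₁ : ContDiffOn ℝ ∞ B₁ D) (hB₂ : ContDiffOn ℝ ∞ B₂ D)
    (hpos : ∀ p ∈ D, 0 < f p) (hint : ∀ p ∈ D, IntegrabilityEquations ε f a b N M B₁ B₂ p) :
    ∃ r > 0, Metric.ball w r ⊆ D ∧ ∀ p₀ x₀ y₀ m₁ m₂ : E42, IsOrthonormalFrame ε x₀ y₀ m₁ m₂ →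
      ∃ z x y n₁ n₂ : ℝ × ℝ → E42,
        IsFramedSurface (Metric.ball w r) ε f a b N M B₁ B₂ z x y n₁ n₂ ∧
        z w = p₀ ∧ x w = x₀ ∧ y w = y₀ ∧ n₁ w = m₁ ∧ n₂ w = m₂ := by
  let P : ℝ × ℝ → Fin 5 → Fin 5 → ℝ := fun p =>
    ![![0, f p, 0, 0, 0], ![0, 0, a p, N p, 0], ![0, a p, 0, 0, M p],
      ![0, -ε * N p, 0, 0, B₁ p], ![0, 0, -ε * M p, B₁ p, 0]]
  let Q : ℝ × ℝ → Fin 5 → Fin 5 → ℝ := fun p =>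
    ![![0, 0, f p, 0, 0], ![0, 0, b p, 0, M p], ![0, b p, 0, N p, 0],
      ![0, 0, ε * N p, 0, B₂ p], ![0, ε * M p, 0, B₂ p, 0]]
  have h0 : ContDiffOn ℝ ∞ (fun _ : ℝ × ℝ => (0 : ℝ)) D := contDiffOn_const
  have hN1 : ContDiffOn ℝ ∞ (fun p => -ε * N p) D := contDiffOn_const.mul hN
  have hN2 : ContDiffOn ℝ ∞ (fun p => ε * N p) D := contDiffOn_const.mul hN
  have hM1 : ContDiffOn ℝ ∞ (fun p => -ε * M p) D := contDiffOn_const.mul hM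
  have hM2 : ContDiffOn ℝ ∞ (fun p => ε * M p) D := contDiffOn_const.mul hM
  have hP : ContDiffOn ℝ ∞ P D := contDiffOn_pi.2 fun i => contDiffOn_pi.2 fun j => by
    fin_cases i <;> fin_cases j <;> assumption
  have hQ : ContDiffOn ℝ ∞ Q D := contDiffOn_pi.2 fun i => contDiffOn_pi.2 fun j => by
    fin_cases i <;> fin_cases j <;> assumption
  obtain ⟨r, hr, hrD, hsol⟩ := exists_linear_system hD hw hP hQ (by
    intro p hp i j
    have hi := hint p hp
    have e0u : du (fun _ : ℝ × ℝ => (0 : ℝ)) p = 0 := by simp [du]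
    have e0v : dv (fun _ : ℝ × ℝ => (0 : ℝ)) p = 0 := by simp [dv]
    have dN := differentiableAt_of_contDiffOn hD hN hp
    have dM := differentiableAt_of_contDiffOn hD hM hp
    have ecu : ∀ c : ℝ, ∀ g : ℝ × ℝ → ℝ, DifferentiableAt ℝ g p →
        du (fun q => c * g q) p = c * du g p := fun c g hg => by
      rw [du, fderiv_const_mul hg]; rfl
    have ecv : ∀ c : ℝ, ∀ g : ℝ × ℝ → ℝ, DifferentiableAt ℝ g p →
        dv (fun q => c * g q) p = c * dv g p := fun c g hg => by
      rw [dv, fderiv_const_mul hg]; rfl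
    simp only [Fin.sum_univ_five]
    -- Excluding `neg_mul` keeps the entries `-ε * N` and `-ε * M` in the shape constant times
    -- function required by `ecu` and `ecv`.
    fin_cases i <;> fin_cases j <;>
      simp [P, Q, e0u, e0v, ecu _ _ dN, ecu _ _ dM, ecv _ _ dN, ecv _ _ dM, -neg_mul] <;>
      (try simp only [hi.fu, hi.fv, hi.gauss, hi.Nu, hi.Nv, hi.Mu, hi.Mv, hi.ricci]) <;> ring)
  refine ⟨r, hr, hrD, fun p₀ x₀ y₀ m₁ m₂ ho => ?_⟩
  choose φ hφ hφw hφd using fun k : Fin 4 => hsol ![p₀ k, x₀ k, y₀ k, m₁ k, m₂ k]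
  have hopen : IsOpen (Metric.ball w r) := Metric.isOpen_ball
  have hwr : w ∈ Metric.ball w r := Metric.mem_ball_self hr
  have hconn : IsConnected (Metric.ball w r) := (convex_ball w r).isConnected ⟨w, hwr⟩
  let e : Fin 5 → ℝ × ℝ → E42 := fun i p k => φ k p i
  have he : ∀ i, ContDiffOn ℝ ∞ (e i) (Metric.ball w r) := fun i =>
    contDiffOn_pi.2 fun k => contDiffOn_pi.1 (hφ k) i
  have hder : ∀ i, ∀ p ∈ Metric.ball w r, ∀ d k, fderiv ℝ (e i) p d k = fderiv ℝ (φ k) p d i := by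
    intro i p hp d k
    rw [← fderiv_coord _ (differentiableAt_of_contDiffOn hopen (he i) hp)]
    change fderiv ℝ (fun q => φ k q i) p d = _
    rw [fderiv_apply (differentiableAt_of_contDiffOn hopen (hφ k) hp)]
    rfl
  have hfe : ∀ p ∈ Metric.ball w r,
      FrameEquations ε f a b N M B₁ B₂ (e 0) (e 1) (e 2) (e 3) (e 4) p := by
    intro p hp
    constructor <;> ext k <;>
      first
      | (rw [du, hder _ p hp, ← du.eq_1, (hφd k p hp _).1]; simp [P, e, Fin.sum_univ_five])
      | (rw [dv, hder _ p hp, ← dv.eq_1, (hφd k p hp _).2]; simp [Q, e, Fin.sum_univ_five])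
  have hew : e 0 w = p₀ ∧ e 1 w = x₀ ∧ e 2 w = y₀ ∧ e 3 w = m₁ ∧ e 4 w = m₂ := by
    refine ⟨?_, ?_, ?_, ?_, ?_⟩ <;> ext k <;> simp [e, hφw]
  obtain ⟨hz, hx, hy, hn₁, hn₂⟩ := hew
  have hdf : ∀ i, DifferentiableOn ℝ (e i) (Metric.ball w r) := fun i =>
    (he i).differentiableOn (by simp)
  refine ⟨e 0, e 1, e 2, e 3, e 4, ⟨hopen, hf.mono hrD, he 0, he 1, he 2, he 3, he 4, ?_, hfe⟩,
    hz, hx, hy, hn₁, hn₂⟩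
  intro p hp
  refine ⟨hε, hpos p (hrD hp), ?_, (hfe p hp).zu, (hfe p hp).zv⟩
  -- The solution is paired with itself: the pairing is constant and has the right value at w.
  rw [isOrthonormalFrame_iff_framePairing hε,
    framePairing_const hopen hconn hε (hdf 1) (hdf 2) (hdf 3) (hdf 4) (hdf 1) (hdf 2) (hdf 3)
      (hdf 4) hfe hfe hp hwr, hx, hy, hn₁, hn₂]
  exact (isOrthonormalFrame_iff_framePairing hε).1 ho

/-! ### The frame equations of a surface with a geometric frame -/

/-- Differentiated orthonormality relations, the symmetry of z_uv and the given values of σ leave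
only the normal connection undetermined; B₁ and B₂ name what remains. -/
theorem exists_isFramedSurface_of_isGeometricFrame {D : Set (ℝ × ℝ)} (hD : IsOpen D) {ε : ℝ}
    (hε : ε = 1 ∨ ε = -1) {μ ν : ℝ × ℝ → ℝ} {z x y n₁ n₂ : ℝ × ℝ → E42}
    (hz : ContDiffOn ℝ ∞ z D) (hg : IsGeometricFrame z D ε μ ν x y n₁ n₂)
    (hi : IsIsothermalAlong z D x y) :
    ∃ f B₁ B₂ : ℝ × ℝ → ℝ, IsFramedSurface D ε f (fun p => dv f p / f p) (fun p => du f p / f p)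
      (fun p => f p * ν p) (fun p => f p * μ p) B₁ B₂ z x y n₁ n₂ := by
  have hε2 : ε * ε = 1 := by rcases hε with rfl | rfl <;> norm_num
  obtain ⟨f, hf⟩ := hi
  have had : ∀ p ∈ D, IsAdapted ε f z x y n₁ n₂ p := fun p hp =>
    ⟨hε, (hf p hp).1, hg.orthonormal p hp, (hf p hp).2.1, (hf p hp).2.2⟩
  -- Isothermality supplies f without any regularity; smoothness comes from f = ⟨z_u, x⟩.
  have hfs : ContDiffOn ℝ ∞ f D :=
    (contDiffOn_ip (contDiffOn_du hD hz) hg.smooth_x).congr fun p hp => by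
      rw [(had p hp).zu, ip_smul_left, (had p hp).frame.xx, mul_one]
  -- The factor -ε turns the product with n₂ into the n₂-component, since ⟨n₂, n₂⟩ = -ε.
  refine ⟨f, fun p => -ε * ip (du n₁ p) (n₂ p), fun p => -ε * ip (dv n₁ p) (n₂ p), hD, hfs, hz,
    hg.smooth_x, hg.smooth_y, hg.smooth_n₁, hg.smooth_n₂, had, ?_⟩
  intro p hp
  have h1 := had p hp
  have o := h1.frame
  have hne := h1.pos.ne'
  have df := differentiableAt_of_contDiffOn hD hfs hp
  have dx := differentiableAt_of_contDiffOn hD hg.smooth_x hp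
  have dy := differentiableAt_of_contDiffOn hD hg.smooth_y hp
  have dn₁ := differentiableAt_of_contDiffOn hD hg.smooth_n₁ hp
  have dn₂ := differentiableAt_of_contDiffOn hD hg.smooth_n₂ hp
  -- derivatives of constant products vanish
  have hcu : ∀ {v w : ℝ × ℝ → E42} {c : ℝ}, DifferentiableAt ℝ v p → DifferentiableAt ℝ w p →
      (∀ q ∈ D, ip (v q) (w q) = c) → ip (du v p) (w p) + ip (v p) (du w p) = 0 := by
    intro v w c hv hw hc
    have := du_congr hD (show EqOn (fun q => ip (v q) (w q)) (fun _ => c) D from hc) hp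
    rw [du, fderiv_ip hv hw] at this
    simpa [du] using this
  have hcv : ∀ {v w : ℝ × ℝ → E42} {c : ℝ}, DifferentiableAt ℝ v p → DifferentiableAt ℝ w p →
      (∀ q ∈ D, ip (v q) (w q) = c) → ip (dv v p) (w p) + ip (v p) (dv w p) = 0 := by
    intro v w c hv hw hc
    have := dv_congr hD (show EqOn (fun q => ip (v q) (w q)) (fun _ => c) D from hc) hp
    rw [dv, fderiv_ip hv hw] at this
    simpa [dv] using this
  -- the mixed derivative of the surface
  have hmix : f p • dv x p + dv f p • x p = f p • du y p + du f p • y p := by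
    have e := du_dv_comm hD hz hp
    rw [du_congr hD (fun q hq => (had q hq).zv) hp, dv_congr hD (fun q hq => (had q hq).zu) hp, du,
      dv, fderiv_smul_apply df dy, fderiv_smul_apply df dx] at e
    exact e.symm
  have ixx := hcu dx dx fun q hq => (had q hq).frame.xx
  have jxx := hcv dx dx fun q hq => (had q hq).frame.xx
  have iyy := hcu dy dy fun q hq => (had q hq).frame.yy
  have jyy := hcv dy dy fun q hq => (had q hq).frame.yy
  have ixy := hcu dx dy fun q hq => (had q hq).frame.xy
  have jxy := hcv dx dy fun q hq => (had q hq).frame.xy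
  rw [ip_comm (x p)] at ixx jxx ixy jxy
  rw [ip_comm (y p)] at iyy jyy
  have ixx0 : ip (du x p) (x p) = 0 := by linarith
  have jxx0 : ip (dv x p) (x p) = 0 := by linarith
  have iyy0 : ip (du y p) (y p) = 0 := by linarith
  have jyy0 : ip (dv y p) (y p) = 0 := by linarith
  -- the normal parts
  have hsec := IsAdapted.secondForm_eq hD had hp df dx dy
  have nxu : normalPart z p (du x p) = (f p * ν p) • n₁ p := by
    have e := hg.sigma_xx p hp
    rw [hsec, o.xx, o.xy] at e
    simp only [one_smul, zero_smul, sub_zero] at e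
    rw [mul_smul, ← e, smul_smul, mul_one_div_cancel hne, one_smul]
  have nyu : normalPart z p (du y p) = (f p * μ p) • n₂ p := by
    have e := hg.sigma_xy p hp
    rw [hsec, o.xx, o.xy, ip_comm (y p), o.xy, o.yy] at e
    simp only [one_smul, zero_smul, sub_zero, zero_sub, neg_smul, neg_neg] at e
    rw [mul_smul, ← e, smul_smul, mul_one_div_cancel hne, one_smul]
  have nyv : normalPart z p (dv y p) = (f p * ν p) • n₁ p := by
    have e := hg.sigma_yy p hp
    rw [hsec, ip_comm (y p), o.xy, o.yy] at e
    simp only [one_smul, zero_smul, zero_sub, neg_smul, neg_neg] at e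
    rw [mul_smul, ← e, smul_smul, mul_one_div_cancel hne, one_smul]
  -- The formula for σ(x, y) differentiates y along x, so x_v is reached through the normal part of
  -- the mixed derivative.
  have nxv : normalPart z p (dv x p) = (f p * μ p) • n₂ p := by
    have e := congrArg (normalPart z p) hmix
    simp only [h1.normalPart_add, h1.normalPart_smul, h1.normalPart_x, h1.normalPart_y, smul_zero,
      add_zero, nyu] at e
    exact (smul_right_injective E42 hne) e
  rw [h1.normalPart_eq_sub] at nxu nyu nyv nxv
  have exu : du x p = (f p * ν p) • n₁ p + (ip (du x p) (x p) • x p - ip (du x p) (y p) • y p) :=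
    sub_eq_iff_eq_add.1 nxu
  have eyu : du y p = (f p * μ p) • n₂ p + (ip (du y p) (x p) • x p - ip (du y p) (y p) • y p) :=
    sub_eq_iff_eq_add.1 nyu
  have exv : dv x p = (f p * μ p) • n₂ p + (ip (dv x p) (x p) • x p - ip (dv x p) (y p) • y p) :=
    sub_eq_iff_eq_add.1 nxv
  have eyv : dv y p = (f p * ν p) • n₁ p + (ip (dv y p) (x p) • x p - ip (dv y p) (y p) • y p) :=
    sub_eq_iff_eq_add.1 nyv
  -- the connection coefficients
  have ha : ip (du y p) (x p) = dv f p / f p := by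
    have e := congrArg (fun v => ip v (x p)) hmix
    simp only [ip_add_left, ip_smul_left, o.xx, ip_comm (y p) (x p), o.xy, jxx0] at e
    rw [eq_div_iff hne]; linarith
  have hb : ip (dv x p) (y p) = -(du f p / f p) := by
    have e := congrArg (fun v => ip v (y p)) hmix
    simp only [ip_add_left, ip_smul_left, o.xy, o.yy, iyy0] at e
    rw [← neg_div, eq_div_iff hne]; linarith
  have ha' : ip (du x p) (y p) = -(dv f p / f p) := by linarith
  have hb' : ip (dv y p) (x p) = du f p / f p := by linarith
  rw [ixx0, ha'] at exu
  rw [iyy0, ha] at eyu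
  rw [jxx0, hb] at exv
  rw [jyy0, hb'] at eyv
  simp only [zero_smul, zero_sub, sub_zero, neg_smul, neg_neg] at exu eyu exv eyv
  have ixn₁ := hcu dx dn₁ fun q hq => (had q hq).frame.xn₁
  have jxn₁ := hcv dx dn₁ fun q hq => (had q hq).frame.xn₁
  have ixn₂ := hcu dx dn₂ fun q hq => (had q hq).frame.xn₂
  have jxn₂ := hcv dx dn₂ fun q hq => (had q hq).frame.xn₂
  have iyn₁ := hcu dy dn₁ fun q hq => (had q hq).frame.yn₁
  have jyn₁ := hcv dy dn₁ fun q hq => (had q hq).frame.yn₁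
  have iyn₂ := hcu dy dn₂ fun q hq => (had q hq).frame.yn₂
  have jyn₂ := hcv dy dn₂ fun q hq => (had q hq).frame.yn₂
  have inn := hcu dn₁ dn₂ fun q hq => (had q hq).frame.n₁n₂
  have jnn := hcv dn₁ dn₂ fun q hq => (had q hq).frame.n₁n₂
  have i11 := hcu dn₁ dn₁ fun q hq => (had q hq).frame.n₁n₁
  have j11 := hcv dn₁ dn₁ fun q hq => (had q hq).frame.n₁n₁
  have i22 := hcu dn₂ dn₂ fun q hq => (had q hq).frame.n₂n₂
  have j22 := hcv dn₂ dn₂ fun q hq => (had q hq).frame.n₂n₂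
  rw [ip_comm (n₁ p)] at inn jnn i11 j11
  rw [ip_comm (n₂ p)] at i22 j22
  rw [ip_comm (x p), exu] at ixn₁ ixn₂
  rw [ip_comm (y p), eyu] at iyn₁ iyn₂
  rw [ip_comm (x p), exv] at jxn₁ jxn₂
  rw [ip_comm (y p), eyv] at jyn₁ jyn₂
  simp only [ip_add_left, ip_smul_left, o.n₁n₁, o.n₂n₂, o.n₁n₂, ip_comm (n₂ p) (n₁ p), o.xn₁, o.xn₂,
    o.yn₁, o.yn₂] at ixn₁ ixn₂ iyn₁ iyn₂ jxn₁ jxn₂ jyn₁ jyn₂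
  refine ⟨h1.zu, h1.zv, by rw [exu, add_comm], by rw [exv, add_comm], by rw [eyu, add_comm],
    by rw [eyv, add_comm], ?_, ?_, ?_, ?_⟩
  all_goals
    refine o.ext_ip hε ?_ ?_ ?_ ?_ <;>
    simp only [ip_add_left, ip_smul_left, o.n₁n₁, o.n₂n₂, o.n₁n₂, ip_comm (n₂ p) (n₁ p), o.xn₁,
      o.xn₂, o.yn₁, o.yn₂, o.xx, o.yy, o.xy, ip_comm (y p) (x p), ip_comm (n₁ p) (x p),
      ip_comm (n₁ p) (y p), ip_comm (n₂ p) (x p), ip_comm (n₂ p) (y p)] <;>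
    first
    | linarith
    | linear_combination (-ip (du n₁ p) (n₂ p)) * hε2
    | linear_combination (-ip (dv n₁ p) (n₂ p)) * hε2
    | linear_combination inn + ip (du n₁ p) (n₂ p) * hε2
    | linear_combination jnn + ip (dv n₁ p) (n₂ p) * hε2

/-- The equations of Gauss and Codazzi. -/
theorem IsFramedSurface.gauss_codazzi {D : Set (ℝ × ℝ)} {ε : ℝ} {f a b N M B₁ B₂ : ℝ × ℝ → ℝ}
    {z x y n₁ n₂ : ℝ × ℝ → E42} {p : ℝ × ℝ}
    (h : IsFramedSurface D ε f a b N M B₁ B₂ z x y n₁ n₂) (hp : p ∈ D)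
    (ha : DifferentiableAt ℝ a p) (hb : DifferentiableAt ℝ b p)
    (hN : DifferentiableAt ℝ N p) (hM : DifferentiableAt ℝ M p) :
    dv a p = du b p - ε * (N p ^ 2 + M p ^ 2) ∧ du N p = M p * B₂ p - b p * N p ∧
      dv N p = M p * B₁ p - a p * N p ∧ du M p = N p * B₂ p - b p * M p ∧
      dv M p = N p * B₁ p - a p * M p := by
  have hD := h.isOpen
  have o := (h.adapted p hp).frame
  have q := h.equations p hp
  have hεne : ε ≠ 0 := by rcases (h.adapted p hp).sign with h | h <;> rw [h] <;> norm_num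
  have dx := differentiableAt_of_contDiffOn hD h.smooth_x hp
  have dy := differentiableAt_of_contDiffOn hD h.smooth_y hp
  have dn₁ := differentiableAt_of_contDiffOn hD h.smooth_n₁ hp
  have dn₂ := differentiableAt_of_contDiffOn hD h.smooth_n₂ hp
  have ex := du_dv_comm hD h.smooth_x hp
  rw [du_congr hD (fun r hr => (h.equations r hr).xv) hp,
    dv_congr hD (fun r hr => (h.equations r hr).xu) hp, du, dv,
    fderiv_smul_add_smul_apply hb hM dy dn₂, fderiv_smul_add_smul_apply ha hN dy dn₁] at ex
  have ey := du_dv_comm hD h.smooth_y hp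
  rw [du_congr hD (fun r hr => (h.equations r hr).yv) hp,
    dv_congr hD (fun r hr => (h.equations r hr).yu) hp, du, dv,
    fderiv_smul_add_smul_apply hb hN dx dn₁, fderiv_smul_add_smul_apply ha hM dx dn₂] at ey
  simp only [← du.eq_1, ← dv.eq_1, q.xu, q.xv, q.yu, q.yv, q.n₁u, q.n₁v, q.n₂u, q.n₂v] at ex ey
  -- The y-component of x_uv = x_vu is the Gauss equation; the normal components for x and y are the
  -- four Codazzi equations.
  have exy := congrArg (fun w => ip w (y p)) ex
  have ex1 := congrArg (fun w => ip w (n₁ p)) ex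
  have ex2 := congrArg (fun w => ip w (n₂ p)) ex
  have ey1 := congrArg (fun w => ip w (n₁ p)) ey
  have ey2 := congrArg (fun w => ip w (n₂ p)) ey
  simp only [ip_add_left, ip_smul_left, o.n₁n₁, o.n₂n₂, o.n₁n₂, ip_comm (n₂ p) (n₁ p), o.xn₁,
    o.xn₂, o.yn₁, o.yn₂, o.yy, o.xy, ip_comm (n₁ p) (y p), ip_comm (n₂ p) (y p)]
    at exy ex1 ex2 ey1 ey2
  refine ⟨by linear_combination exy, mul_left_cancel₀ hεne ?_, mul_left_cancel₀ hεne ?_,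
    mul_left_cancel₀ hεne ?_, mul_left_cancel₀ hεne ?_⟩
  · linear_combination ey1
  · linear_combination -ex1
  · linear_combination -ex2
  · linear_combination ey2

/-! ### The coefficients determined by the geometric functions -/

section Canonical

variable (μ ν : ℝ × ℝ → ℝ)

/-- `ln |μ² - ν²|`. -/
noncomputable def logDiff (p : ℝ × ℝ) : ℝ := Real.log |μ p ^ 2 - ν p ^ 2|

/-- `ln |(μ + ν) / (μ - ν)|`. -/
noncomputable def logQuot (p : ℝ × ℝ) : ℝ := Real.log |(μ p + ν p) / (μ p - ν p)|

/-- The scale factor `|μ² - ν²|^(-1/4)` of canonical parameters. -/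
noncomputable def canonicalScale (p : ℝ × ℝ) : ℝ := Real.exp (-(1 / 4) * logDiff μ ν p)

theorem canonicalScale_pos (p : ℝ × ℝ) : 0 < canonicalScale μ ν p := Real.exp_pos _

variable {μ ν} {p : ℝ × ℝ}

theorem canonicalScale_sq_mul_sqrt (h : μ p ^ 2 - ν p ^ 2 ≠ 0) :
    canonicalScale μ ν p ^ 2 * √|μ p ^ 2 - ν p ^ 2| = 1 := by
  have h1 : √|μ p ^ 2 - ν p ^ 2| = Real.exp (logDiff μ ν p / 2) := by
    rw [Real.exp_half, logDiff, Real.exp_log (abs_pos.2 h)]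
  rw [h1, canonicalScale, ← Real.exp_nat_mul, ← Real.exp_add, Real.exp_eq_one_iff]
  push_cast
  ring

theorem canonicalScale_sq (h : μ p ^ 2 - ν p ^ 2 ≠ 0) :
    canonicalScale μ ν p ^ 2 = 1 / √|μ p ^ 2 - ν p ^ 2| := by
  have h0 : √|μ p ^ 2 - ν p ^ 2| ≠ 0 := Real.sqrt_ne_zero'.2 (abs_pos.2 h)
  rw [eq_div_iff h0, canonicalScale_sq_mul_sqrt h]

theorem eq_canonicalScale {c : ℝ} (hc : 0 < c) (h : μ p ^ 2 - ν p ^ 2 ≠ 0)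
    (hc' : c ^ 2 * √|μ p ^ 2 - ν p ^ 2| = 1) : c = canonicalScale μ ν p := by
  have h0 : √|μ p ^ 2 - ν p ^ 2| ≠ 0 := Real.sqrt_ne_zero'.2 (abs_pos.2 h)
  have : c ^ 2 = canonicalScale μ ν p ^ 2 :=
    mul_right_cancel₀ h0 (hc'.trans (canonicalScale_sq_mul_sqrt h).symm)
  exact (pow_left_inj₀ hc.le (canonicalScale_pos μ ν p).le two_ne_zero).1 this

theorem add_ne_zero_and_sub_ne_zero (h : μ p ^ 2 - ν p ^ 2 ≠ 0) :
    μ p + ν p ≠ 0 ∧ μ p - ν p ≠ 0 := by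
  rw [sq_sub_sq] at h
  exact mul_ne_zero_iff.1 h

theorem fderiv_logDiff (hμ : DifferentiableAt ℝ μ p) (hν : DifferentiableAt ℝ ν p)
    (h : μ p ^ 2 - ν p ^ 2 ≠ 0) (e : ℝ × ℝ) :
    fderiv ℝ (logDiff μ ν) p e
      = (2 * μ p * fderiv ℝ μ p e - 2 * ν p * fderiv ℝ ν p e) / (μ p ^ 2 - ν p ^ 2) := by
  have h1 : logDiff μ ν = fun q => Real.log (μ q ^ 2 - ν q ^ 2) := by
    ext q; rw [logDiff, Real.log_abs]
  have h2 : HasFDerivAt (fun q => μ q ^ 2 - ν q ^ 2) _ p :=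
    (hμ.hasFDerivAt.pow 2).sub (hν.hasFDerivAt.pow 2)
  rw [h1, (h2.log h).fderiv]
  simp
  ring

theorem fderiv_logQuot (hμ : DifferentiableAt ℝ μ p) (hν : DifferentiableAt ℝ ν p)
    (h : μ p ^ 2 - ν p ^ 2 ≠ 0) (e : ℝ × ℝ) :
    fderiv ℝ (logQuot μ ν) p e
      = (2 * μ p * fderiv ℝ ν p e - 2 * ν p * fderiv ℝ μ p e) / (μ p ^ 2 - ν p ^ 2) := by
  obtain ⟨h2, h3⟩ := add_ne_zero_and_sub_ne_zero h
  have hev : logQuot μ ν =ᶠ[nhds p] fun q => Real.log (μ q + ν q) - Real.log (μ q - ν q) := by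
    filter_upwards [(hμ.fun_add hν).continuousAt.eventually_ne h2,
      (hμ.fun_sub hν).continuousAt.eventually_ne h3] with q h4 h5
    rw [logQuot, Real.log_abs, Real.log_div h4 h5]
  rw [hev.fderiv_eq, (((hμ.hasFDerivAt.fun_add hν.hasFDerivAt).log h2).fun_sub
    ((hμ.hasFDerivAt.fun_sub hν.hasFDerivAt).log h3)).fderiv]
  simp only [_root_.sub_apply, _root_.add_apply, _root_.smul_apply, smul_eq_mul]
  rw [sq_sub_sq] at h ⊢
  field_simp
  ring

variable {D : Set (ℝ × ℝ)}

theorem contDiffOn_logDiff (hμ : ContDiffOn ℝ ∞ μ D) (hν : ContDiffOn ℝ ∞ ν D)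
    (h : ∀ p ∈ D, μ p ^ 2 - ν p ^ 2 ≠ 0) : ContDiffOn ℝ ∞ (logDiff μ ν) D :=
  (((hμ.pow 2).sub (hν.pow 2)).log h).congr fun p _ => by rw [logDiff, Real.log_abs]

theorem contDiffOn_logQuot (hμ : ContDiffOn ℝ ∞ μ D) (hν : ContDiffOn ℝ ∞ ν D)
    (h : ∀ p ∈ D, μ p ^ 2 - ν p ^ 2 ≠ 0) : ContDiffOn ℝ ∞ (logQuot μ ν) D := by
  have h1 := fun p hp => (add_ne_zero_and_sub_ne_zero (h p hp)).1
  have h2 := fun p hp => (add_ne_zero_and_sub_ne_zero (h p hp)).2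
  exact (((hμ.add hν).div (hμ.sub hν) h2).log fun p hp => div_ne_zero (h1 p hp) (h2 p hp)).congr
    fun p _ => by rw [logQuot, Real.log_abs]; rfl

theorem contDiffOn_canonicalScale (hμ : ContDiffOn ℝ ∞ μ D) (hν : ContDiffOn ℝ ∞ ν D)
    (h : ∀ p ∈ D, μ p ^ 2 - ν p ^ 2 ≠ 0) : ContDiffOn ℝ ∞ (canonicalScale μ ν) D :=
  (contDiffOn_const.mul (contDiffOn_logDiff hμ hν h)).exp

theorem fderiv_canonicalScale (hL : DifferentiableAt ℝ (logDiff μ ν) p) (e : ℝ × ℝ) :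
    fderiv ℝ (canonicalScale μ ν) p e
      = canonicalScale μ ν p * (-(1 / 4) * fderiv ℝ (logDiff μ ν) p e) := by
  have h := (hL.hasFDerivAt.const_mul (-(1 / 4))).exp
  change HasFDerivAt (canonicalScale μ ν) _ p at h
  rw [h.fderiv]
  rfl

theorem fderiv_const_mul_apply {g : ℝ × ℝ → ℝ} (hg : DifferentiableAt ℝ g p) (c : ℝ) (e : ℝ × ℝ) :
    fderiv ℝ (fun q => c * g q) p e = c * fderiv ℝ g p e := by
  rw [fderiv_const_mul hg]; rfl

/-- The natural equations of a minimal Lorentz surface of general type in canonical parameters. -/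
def NaturalEquations (ε : ℝ) (μ ν : ℝ × ℝ → ℝ) (p : ℝ × ℝ) : Prop :=
  √|μ p ^ 2 - ν p ^ 2| * hypLaplacian (logDiff μ ν) p = -4 * ε * (μ p ^ 2 + ν p ^ 2) ∧
    √|μ p ^ 2 - ν p ^ 2| * hypLaplacian (logQuot μ ν) p = -4 * ε * (μ p * ν p)

/-- The differentials of the two logarithms determine those of μ and ν by dν = ½(ν dL + μ dP) and dμ
= ½(μ dL + ν dP), where L = ln|μ² - ν²| and P = ln|(μ + ν)/(μ - ν)|. This is Codazzi, valid for
arbitrary μ, ν. The natural equations enter only for Gauss and Ricci, after multiplication by s =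
√|μ² - ν²| and use of F² s = 1 for the canonical scale F. -/
theorem integrable_canonical (hD : IsOpen D) (hμ : ContDiffOn ℝ ∞ μ D) (hν : ContDiffOn ℝ ∞ ν D)
    (h : ∀ p ∈ D, μ p ^ 2 - ν p ^ 2 ≠ 0) {ε : ℝ} (hp : p ∈ D) (heq : NaturalEquations ε μ ν p) :
    IntegrabilityEquations ε (canonicalScale μ ν) (fun q => -(1 / 4) * dv (logDiff μ ν) q)
      (fun q => -(1 / 4) * du (logDiff μ ν) q) (fun q => canonicalScale μ ν q * ν q)
      (fun q => canonicalScale μ ν q * μ q) (fun q => 1 / 2 * dv (logQuot μ ν) q)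
      (fun q => 1 / 2 * du (logQuot μ ν) q) p := by
  have hL := contDiffOn_logDiff hμ hν h
  have hP := contDiffOn_logQuot hμ hν h
  have dL := differentiableAt_of_contDiffOn hD hL hp
  have dμ := differentiableAt_of_contDiffOn hD hμ hp
  have dν := differentiableAt_of_contDiffOn hD hν hp
  have dF := differentiableAt_of_contDiffOn hD (contDiffOn_canonicalScale hμ hν h) hp
  have hne := h p hp
  have hF := canonicalScale_sq_mul_sqrt hne
  set s := √|μ p ^ 2 - ν p ^ 2| with hs
  have hs0 : s ≠ 0 := Real.sqrt_ne_zero'.2 (abs_pos.2 hne)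
  obtain ⟨h1, h2⟩ := heq
  rw [hypLaplacian, ← hs] at h1 h2
  constructor
  · rw [du, fderiv_canonicalScale dL, du]
  · rw [dv, fderiv_canonicalScale dL, dv]
  · rw [dv, du, fderiv_const_mul_apply (differentiableAt_of_contDiffOn hD (contDiffOn_dv hD hL) hp),
      fderiv_const_mul_apply (differentiableAt_of_contDiffOn hD (contDiffOn_du hD hL) hp),
      ← dv.eq_1, ← du.eq_1]
    apply mul_left_cancel₀ hs0
    linear_combination (1 / 4) * h1 + ε * (μ p ^ 2 + ν p ^ 2) * hF
  · rw [du, fderiv_mul_apply dF dν, fderiv_canonicalScale dL, du, du, fderiv_logDiff dμ dν hne,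
      fderiv_logQuot dμ dν hne]
    field_simp
    ring
  · rw [dv, fderiv_mul_apply dF dν, fderiv_canonicalScale dL, dv, dv, fderiv_logDiff dμ dν hne,
      fderiv_logQuot dμ dν hne]
    field_simp
    ring
  · rw [du, fderiv_mul_apply dF dμ, fderiv_canonicalScale dL, du, du, fderiv_logDiff dμ dν hne,
      fderiv_logQuot dμ dν hne]
    field_simp
    ring
  · rw [dv, fderiv_mul_apply dF dμ, fderiv_canonicalScale dL, dv, dv, fderiv_logDiff dμ dν hne,
      fderiv_logQuot dμ dν hne]
    field_simp
    ring
  · rw [dv, du, fderiv_const_mul_apply (differentiableAt_of_contDiffOn hD (contDiffOn_dv hD hP) hp),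
      fderiv_const_mul_apply (differentiableAt_of_contDiffOn hD (contDiffOn_du hD hP) hp),
      ← dv.eq_1, ← du.eq_1]
    apply mul_left_cancel₀ hs0
    linear_combination -(1 / 2) * h2 - 2 * ε * μ p * ν p * hF

/-- The frame equations with the coefficients determined by the geometric functions. -/
abbrev CanonicalFrameEquations (ε : ℝ) (μ ν : ℝ × ℝ → ℝ) (z x y n₁ n₂ : ℝ × ℝ → E42)
    (p : ℝ × ℝ) : Prop :=
  FrameEquations ε (canonicalScale μ ν) (fun q => -(1 / 4) * dv (logDiff μ ν) q)
      (fun q => -(1 / 4) * du (logDiff μ ν) q) (fun q => canonicalScale μ ν q * ν q)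
      (fun q => canonicalScale μ ν q * μ q) (fun q => 1 / 2 * dv (logQuot μ ν) q)
      (fun q => 1 / 2 * du (logQuot μ ν) q) z x y n₁ n₂ p

/-- The coefficients of the frame equations are determined by the geometric functions, and so is
the sign of the frame. -/
theorem canonicalFrameEquations_of_isGeometricFrame (hD : IsOpen D) (hμ : ContDiffOn ℝ ∞ μ D)
    (hν : ContDiffOn ℝ ∞ ν D) (h : ∀ p ∈ D, μ p ^ 2 - ν p ^ 2 ≠ 0) {ε ε' : ℝ}
    (hε : ε = 1 ∨ ε = -1) (hε' : ε' = 1 ∨ ε' = -1) (heq : ∀ p ∈ D, NaturalEquations ε μ ν p)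
    {z x y n₁ n₂ : ℝ × ℝ → E42}
    (hz : ContDiffOn ℝ ∞ z D) (hg : IsGeometricFrame z D ε' μ ν x y n₁ n₂)
    (hi : IsIsothermalAlong z D x y) (hp : p ∈ D) :
    ε' = ε ∧ CanonicalFrameEquations ε μ ν z x y n₁ n₂ p := by
  obtain ⟨f, B₁, B₂, hs⟩ := exists_isFramedSurface_of_isGeometricFrame hD hε' hz hg hi
  have hfs := hs.smooth_f
  have hfpos : ∀ q ∈ D, 0 < f q := fun q hq => (hs.adapted q hq).pos
  have hL := contDiffOn_logDiff hμ hν h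
  have hgc := fun q (hq : q ∈ D) => hs.gauss_codazzi hq
    (differentiableAt_of_contDiffOn hD
      ((contDiffOn_dv hD hfs).div hfs fun r hr => (hfpos r hr).ne') hq)
    (differentiableAt_of_contDiffOn hD
      ((contDiffOn_du hD hfs).div hfs fun r hr => (hfpos r hr).ne') hq)
    (differentiableAt_of_contDiffOn hD (hfs.mul hν) hq)
    (differentiableAt_of_contDiffOn hD (hfs.mul hμ) hq)
  have hlogu : EqOn (fun q => du f q / f q) (fun q => -(1 / 4) * du (logDiff μ ν) q) D := by
    intro q hq
    have hf0 := (hfpos q hq).ne'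
    have hne := h q hq
    have dμ := differentiableAt_of_contDiffOn hD hμ hq
    have dν := differentiableAt_of_contDiffOn hD hν hq
    have df := differentiableAt_of_contDiffOn hD hfs hq
    obtain ⟨-, e1, -, e2, -⟩ := hgc q hq
    simp only [du, fderiv_mul_apply df dμ, fderiv_mul_apply df dν] at e1 e2
    simp only [du, fderiv_logDiff dμ dν hne]
    field_simp at e1 e2 ⊢
    -- In μ M_u - ν N_u the unknown B₂ drops out because μ N = ν M, which leaves an equation for f_u
    -- / f alone.
    linear_combination 2 * μ q * e2 - 2 * ν q * e1
  have hlogv : EqOn (fun q => dv f q / f q) (fun q => -(1 / 4) * dv (logDiff μ ν) q) D := by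
    intro q hq
    have hf0 := (hfpos q hq).ne'
    have hne := h q hq
    have dμ := differentiableAt_of_contDiffOn hD hμ hq
    have dν := differentiableAt_of_contDiffOn hD hν hq
    have df := differentiableAt_of_contDiffOn hD hfs hq
    obtain ⟨-, -, e1, -, e2⟩ := hgc q hq
    simp only [dv, fderiv_mul_apply df dμ, fderiv_mul_apply df dν] at e1 e2
    simp only [dv, fderiv_logDiff dμ dν hne]
    field_simp at e1 e2 ⊢
    linear_combination 2 * μ q * e2 - 2 * ν q * e1
  have hboth : ∀ q ∈ D, ε' = ε ∧ f q = canonicalScale μ ν q := by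
    intro q hq
    have hf0 := hfpos q hq
    have hne := h q hq
    obtain ⟨e1, -⟩ := hgc q hq
    rw [dv_congr hD hlogv hq, du_congr hD hlogu hq, dv, du,
      fderiv_const_mul_apply (differentiableAt_of_contDiffOn hD (contDiffOn_dv hD hL) hq),
      fderiv_const_mul_apply (differentiableAt_of_contDiffOn hD (contDiffOn_du hD hL) hq),
      ← dv.eq_1, ← du.eq_1] at e1
    have e2 := (heq q hq).1
    rw [hypLaplacian] at e2
    set s := √|μ q ^ 2 - ν q ^ 2| with hsdef
    have hs0 : 0 < s := Real.sqrt_pos.2 (abs_pos.2 hne)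
    have hprod := hg.mul_ne_zero q hq
    have hμν : μ q ^ 2 + ν q ^ 2 ≠ 0 := by
      have : μ q ≠ 0 := left_ne_zero_of_mul hprod
      positivity
    -- The Gauss equation of the surface and the first natural equation have the same left side up
    -- to the factor s. As f² s > 0, this single identity gives both ε' = ε and f² s = 1, with no
    -- integration constant left over.
    have e3 : ε' * (f q ^ 2 * s) = ε := by
      apply mul_right_cancel₀ hμν
      linear_combination s * e1 - (1 / 4) * e2
    have hpos : 0 < f q ^ 2 * s := by positivity
    have hεε : ε' = ε := by
      rcases hε with rfl | rfl <;> rcases hε' with rfl | rfl <;> first | rfl | (exfalso; linarith)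
    refine ⟨hεε, eq_canonicalScale hf0 hne ?_⟩
    rw [hεε] at e3
    have hεne : ε ≠ 0 := by rcases hε with h | h <;> rw [h] <;> norm_num
    exact mul_left_cancel₀ hεne (e3.trans (mul_one ε).symm)
  have hfeq : EqOn f (canonicalScale μ ν) D := fun q hq => (hboth q hq).2
  have hεε := (hboth p hp).1
  subst hεε
  refine ⟨rfl, ?_⟩
  have hint := integrable_canonical hD hμ hν h hp (heq p hp)
  obtain ⟨-, cu, cv, -, -⟩ := hgc p hp
  have hfp := hfeq hp
  have hMne : canonicalScale μ ν p * μ p ≠ 0 :=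
    mul_ne_zero (canonicalScale_pos μ ν p).ne' (left_ne_zero_of_mul (hg.mul_ne_zero p hp))
  have hNeq : EqOn (fun q => f q * ν q) (fun q => canonicalScale μ ν q * ν q) D := fun q hq => by
    simp only [hfeq hq]
  have hau := hlogu hp
  have hav := hlogv hp
  simp only at hau hav
  -- The surface and the canonical coefficients satisfy Codazzi equations with the same N, M, a, b;
  -- their difference is M times the difference of the B's, and M ≠ 0.
  have hB₁ : B₁ p = 1 / 2 * dv (logQuot μ ν) p := by
    rw [dv_congr hD hNeq hp, hint.Nv, hav, hfp] at cv
    exact mul_left_cancel₀ hMne (by linarith)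
  have hB₂ : B₂ p = 1 / 2 * du (logQuot μ ν) p := by
    rw [du_congr hD hNeq hp, hint.Nu, hau, hfp] at cu
    exact mul_left_cancel₀ hMne (by linarith)
  have q := hs.equations p hp
  refine ⟨?_, ?_, ?_, ?_, ?_, ?_, ?_, ?_, ?_, ?_⟩ <;>
    simp only [← hfp, ← hau, ← hav, ← hB₁, ← hB₂]
  exacts [q.zu, q.zv, q.xu, q.xv, q.yu, q.yv, q.n₁u, q.n₁v, q.n₂u, q.n₂v]

end Canonical

end BonnetLorentz

/-! ### Existence, uniqueness and rigidity -/

open BonnetLorentz in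
theorem mainTheorem1 (D : Set (ℝ × ℝ)) (hDo : IsOpen D) (hDc : IsConnected D)
    (μ ν : ℝ × ℝ → ℝ) (hμ : ContDiffOn ℝ ∞ μ D) (hν : ContDiffOn ℝ ∞ ν D)
    (ε : ℝ) (hε : ε = 1 ∨ ε = -1)
    (hprod : ∀ p ∈ D, μ p * ν p ≠ 0)
    (hdiff : ∀ p ∈ D, μ p ^ 2 - ν p ^ 2 ≠ 0)
    (heq₁ : ∀ p ∈ D,
      √|μ p ^ 2 - ν p ^ 2| * hypLaplacian (fun q => Real.log |μ q ^ 2 - ν q ^ 2|) p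
        = -4 * ε * (μ p ^ 2 + ν p ^ 2))
    (heq₂ : ∀ p ∈ D,
      √|μ p ^ 2 - ν p ^ 2| * hypLaplacian (fun q => Real.log |(μ q + ν q) / (μ q - ν q)|) p
        = -4 * ε * (μ p * ν p)) :
    (∀ w₀ ∈ D, ∀ p₀ x₀ y₀ m₁ m₂ : E42, IsOrthonormalFrame ε x₀ y₀ m₁ m₂ →
      ∃ D₀ ⊆ D, IsOpen D₀ ∧ IsConnected D₀ ∧ w₀ ∈ D₀ ∧
        ∃ z : ℝ × ℝ → E42,
          IsSurfaceThrough z D₀ ε μ ν w₀ p₀ x₀ y₀ m₁ m₂ ∧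
          IsCanonical z D₀ μ ν ∧
          ∀ z' : ℝ × ℝ → E42, IsSurfaceThrough z' D₀ ε μ ν w₀ p₀ x₀ y₀ m₁ m₂ → EqOn z' z D₀) ∧
    (∀ D₁ ⊆ D, IsOpen D₁ → IsConnected D₁ → ∀ z₁ z₂ : ℝ × ℝ → E42,
      IsSurfaceWithInvariants z₁ D₁ μ ν → IsSurfaceWithInvariants z₂ D₁ μ ν →
        ∃ T : E42 → E42, IsRigidMotion T ∧ ∀ p ∈ D₁, z₂ p = T (z₁ p)) := by
  have heq : ∀ p ∈ D, NaturalEquations ε μ ν p := fun p hp => ⟨heq₁ p hp, heq₂ p hp⟩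
  have hL := contDiffOn_logDiff hμ hν hdiff
  have hP := contDiffOn_logQuot hμ hν hdiff
  have hF := contDiffOn_canonicalScale hμ hν hdiff
  have hB₁ : ContDiffOn ℝ ∞ (fun q => 1 / 2 * dv (logQuot μ ν) q) D :=
    contDiffOn_const.mul (contDiffOn_dv hDo hP)
  have hB₂ : ContDiffOn ℝ ∞ (fun q => 1 / 2 * du (logQuot μ ν) q) D :=
    contDiffOn_const.mul (contDiffOn_du hDo hP)
  have hdf : ∀ {g : ℝ × ℝ → E42} {U : Set (ℝ × ℝ)}, ContDiffOn ℝ ∞ g U → DifferentiableOn ℝ g U :=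
    fun hg => hg.differentiableOn (by simp)
  constructor
  · intro w₀ hw₀ p₀ x₀ y₀ m₁ m₂ ho
    obtain ⟨r, hr, hrD, hsol⟩ := exists_framedSurface hDo hw₀ hε hF
      (contDiffOn_const.mul (contDiffOn_dv hDo hL)) (contDiffOn_const.mul (contDiffOn_du hDo hL))
      (hF.mul hν) (hF.mul hμ) hB₁ hB₂ (fun p _ => canonicalScale_pos μ ν p)
      (fun p hp => integrable_canonical hDo hμ hν hdiff hp (heq p hp))
    obtain ⟨z, x, y, n₁, n₂, hs, hz, hx, hy, hn₁, hn₂⟩ := hsol p₀ x₀ y₀ m₁ m₂ ho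
    have hw : w₀ ∈ Metric.ball w₀ r := Metric.mem_ball_self hr
    have hconn : IsConnected (Metric.ball w₀ r) := (convex_ball w₀ r).isConnected ⟨w₀, hw⟩
    refine ⟨Metric.ball w₀ r, hrD, Metric.isOpen_ball, hconn, hw, z, ⟨?_, hz, x, y, n₁, n₂,
      hs.isGeometricFrame (fun _ _ => rfl) (fun _ _ => rfl) fun p hp => hprod p (hrD hp),
      hs.isIsothermalAlong, hx, hy, hn₁, hn₂⟩, ?_, ?_⟩
    · have hFne := fun p => (canonicalScale_pos μ ν p).ne'
      refine hs.isMinimalLorentzOfGeneralType (hB₁.mono hrD) (hB₂.mono hrD) (fun p hp => ?_)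
        (fun p hp => mul_ne_zero (hFne p) (right_ne_zero_of_mul (hprod p (hrD hp))))
        (fun p hp => mul_ne_zero (hFne p) (left_ne_zero_of_mul (hprod p (hrD hp))))
        (fun p hp => ?_)
      · linarith [(integrable_canonical hDo hμ hν hdiff (hrD hp) (heq p (hrD hp))).ricci]
      · rw [mul_pow, mul_pow, ← mul_sub]
        refine mul_ne_zero (pow_ne_zero 2 (hFne p)) fun h0 => hdiff p (hrD hp) ?_
        linarith
    · intro p hp
      have ha := hs.adapted p hp
      rw [← canonicalScale_sq (hdiff p (hrD hp))]
      exact ⟨ha.coeffE_eq, ha.coeffF_eq, ha.coeffG_eq⟩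
    · rintro z' ⟨hz's, hz', x', y', n₁', n₂', hg', hi', hx', hy', hn₁', hn₂'⟩ p hp
      have hfe' := fun q hq => (canonicalFrameEquations_of_isGeometricFrame Metric.isOpen_ball
        (hμ.mono hrD) (hν.mono hrD) (fun q hq => hdiff q (hrD hq)) hε hε
        (fun q hq => heq q (hrD hq)) hz's.smooth hg' hi' (p := q) hq).2
      -- Both frames have the same value at w₀, so the linear map between them is the identity; the
      -- equal base points remove the translation.
      rw [eq_frameMap_of_frameEquations Metric.isOpen_ball hconn hε (hdf hs.smooth_z)
        (hdf hz's.smooth) (hdf hs.smooth_x) (hdf hs.smooth_y) (hdf hs.smooth_n₁) (hdf hs.smooth_n₂)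
        (hdf hg'.smooth_x) (hdf hg'.smooth_y) (hdf hg'.smooth_n₁) (hdf hg'.smooth_n₂) hs.equations
        hfe' (fun q hq => (hs.adapted q hq).frame) hw hp, hx', hy', hn₁', hn₂', hx, hy, hn₁, hn₂,
        hz', hz, ho.frameMap_self hε, sub_add_cancel]
  · rintro D₁ hD₁ ho hc z₁ z₂ ⟨hz₁, ε₁, hε₁, x, y, n₁, n₂, hg₁, hi₁⟩
      ⟨hz₂, ε₂, hε₂, x', y', m₁, m₂, hg₂, hi₂⟩
    have h₁ := fun q hq => canonicalFrameEquations_of_isGeometricFrame ho (hμ.mono hD₁)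
      (hν.mono hD₁) (fun q hq => hdiff q (hD₁ hq)) hε hε₁ (fun q hq => heq q (hD₁ hq)) hz₁.smooth
      hg₁ hi₁ (p := q) hq
    have h₂ := fun q hq => canonicalFrameEquations_of_isGeometricFrame ho (hμ.mono hD₁)
      (hν.mono hD₁) (fun q hq => hdiff q (hD₁ hq)) hε hε₂ (fun q hq => heq q (hD₁ hq)) hz₂.smooth
      hg₂ hi₂ (p := q) hq
    obtain ⟨w, hw⟩ := hc.nonempty
    have e₁ := (h₁ w hw).1
    have e₂ := (h₂ w hw).1
    -- The two surfaces may come with different signs a priori; the natural equations force both to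
    -- be ε, so their frames can be matched by an isometry.
    subst e₁ e₂
    obtain ⟨A, hA, hiso⟩ := (hg₁.orthonormal w hw).exists_linearEquiv hε (hg₂.orthonormal w hw)
    refine ⟨fun v => A v + (z₂ w - A (z₁ w)), ⟨A, _, hiso, fun v => rfl⟩, fun p hp => ?_⟩
    rw [eq_frameMap_of_frameEquations ho hc hε (hdf hz₁.smooth) (hdf hz₂.smooth)
      (hdf hg₁.smooth_x) (hdf hg₁.smooth_y) (hdf hg₁.smooth_n₁) (hdf hg₁.smooth_n₂)
      (hdf hg₂.smooth_x) (hdf hg₂.smooth_y) (hdf hg₂.smooth_n₁) (hdf hg₂.smooth_n₂)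
      (fun q hq => (h₁ q hq).2) (fun q hq => (h₂ q hq).2) hg₁.orthonormal hw hp, ← hA, map_sub]
    exact (sub_add_eq_add_sub _ _ _).trans (add_sub_assoc _ _ _)
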